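/- Let $\alpha>0$, $L>0$ be fixed, let $n\to\infty$ and $p\to\infty$, and let $\varphi=\varphi_{n,p}>0$. Let $X_1,\dots,X_n$ be i.i.d. $\mathcal N_p(0,\Sigma)$ vectors, $X_k=(X_{k,1},\dots,X_{k,p})^\top$, and denote by $\mathbb P_\Sigma,\mathbb E_\Sigma$ the corresponding probability and expectation. Let $\mathcal F(\alpha,L)$ be the set of positive semidefinite $p\times p$ matrices $\Sigma=(\sigma_{ij})$ with $\sigma_{ii}=1$ for all $i$ and $\frac1p\sum_{1\le i<j\le p}\sigma_{ij}^2|i-j|^{2\alpha}\le L$, and let $$Q(\alpha,L,\varphi)=\Big\{\Sigma\in\mathcal F(\alpha,L):\ \tfrac1p\sum_{1\le i<j\le p}\sigma_{ij}^2\ge\varphi^2\Big\}.$$ For a test $\Delta$ (a measurable function of the observations with values in $[0,1]$) put $\eta(\Delta)=\mathbb E_I(\Delta)$, where $I$ is the identity matrix, $\beta(\Delta,Q)=\sup_{\Sigma\in Q}\mathbb E_\Sigma(1-\Delta)$ and $\gamma(\Delta,Q)=\eta(\Delta)+\beta(\Delta,Q)$. Let $$C_T=((4\alpha+1)L)^{\frac1{2\alpha}},\quad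 C_\lambda=\frac{2\alpha+1}{2\alpha}((4\alpha+1)L)^{-\frac1{2\alpha}},\quad C(\alpha,L)=\frac{2\alpha+1}{(4\alpha+1)^{1+1/(2\alpha)}}L^{-\frac1{2\alpha}},$$ $$T=\lfloor C_T\,\varphi^{-1/\alpha}\rfloor,\quad \lambda=C_\lambda\,\varphi^{\frac{2\alpha+1}{\alpha}},\quad b(\varphi)=C^{1/2}(\alpha,L)\,\varphi^{2+\frac1{2\alpha}},$$ $$w^*_{ij}=\frac{\lambda}{2b(\varphi)}\Big(1-\Big(\frac{|i-j|}{T}\Big)^{2\alpha}\Big)_+\quad(w^*_{ij}=0\text{ if }|i-j|>T),$$ $$\widehat{\mathcal D}_n=\frac1{n(n-1)p}\sum_{1\le k\ne l\le n}\ \sum_{1\le i<j\le p}w^*_{ij}X_{k,i}X_{k,j}X_{l,i}X_{l,j},$$ and, for $t>0$, let $\Delta^*(t)=\mathbf 1(\widehat{\mathcal D}_n>t)$. (1) Type I error: if $t=t_{n,p}>0$ satisfies $n\sqrt p\,t\to+\infty$, then $\eta(\Delta^*(t))\to0$. (2) Type II error: if $\alpha>1/2$, $\varphi\to0$, $p\varphi^{1/\alpha}\to\infty$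 and $n^2p\,b^2(\varphi)\to+\infty$, then for every fixed $c\in(0,1)$, $$\sup_{0<t\le c\,b(\varphi)}\beta(\Delta^*(t),Q(\alpha,L,\varphi))\to0.$$ (3) If $t=t_{n,p}>0$ satisfies both $n\sqrt p\,t\to+\infty$ and $t\le c\,b(\varphi)$ for a fixed $c\in(0,1)$, and the conditions of (2) hold, then $\Delta^*(t)$ is asymptotically minimax consistent, i.e. $\gamma(\Delta^*(t),Q(\alpha,L,\varphi))\to0$. -/

import Mathlib

open MeasureTheory ProbabilityTheory Filter Topology
open scoped ENNReal

noncomputable section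

namespace CovTest

/-- The sample space of `n` observations `X_1, …, X_n`, each a vector of `ℝ^p`;
`x k i` is the coordinate `X_{k,i}`. -/
abbrev Sample (n p : ℕ) : Type := Fin n → EuclideanSpace ℝ (Fin p)

/-- The joint law `P_Σ` of `n` independent centred Gaussian vectors with covariance matrix `S`. -/
def sampleLaw (n p : ℕ) (S : Matrix (Fin p) (Fin p) ℝ) : Measure (Sample n p) :=
  Measure.pi fun _ : Fin n => multivariateGaussian (0 : EuclideanSpace ℝ (Fin p)) S

/-- The distance `|i - j|` of two indices, as a real number. -/
def idxDist {p : ℕ} (i j : Fin p) : ℝ := |((i : ℕ) : ℝ) - ((j : ℕ) : ℝ)|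

/-- The class `F(α, L)` of `p × p` covariance matrices. -/
def classF (p : ℕ) (α L : ℝ) : Set (Matrix (Fin p) (Fin p) ℝ) :=
  {S | S.PosSemidef ∧ (∀ i, S i i = 1) ∧
    1 / (p : ℝ) * ∑ i, ∑ j ∈ Finset.Ioi i, S i j ^ 2 * idxDist i j ^ (2 * α) ≤ L}

/-- The alternative `Q(α, L, φ)`. -/
def classQ (p : ℕ) (α L φ : ℝ) : Set (Matrix (Fin p) (Fin p) ℝ) :=
  {S | S ∈ classF p α L ∧ φ ^ 2 ≤ 1 / (p : ℝ) * ∑ i, ∑ j ∈ Finset.Ioi i, S i j ^ 2}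

/-- The constant `C_T(α, L)`. -/
def constT (α L : ℝ) : ℝ := ((4 * α + 1) * L) ^ (1 / (2 * α))

/-- The constant `C_λ(α, L)`. -/
def constLam (α L : ℝ) : ℝ :=
  (2 * α + 1) / (2 * α) * ((4 * α + 1) * L) ^ (-(1 / (2 * α)))

/-- The constant `C(α, L)`. -/
def constC (α L : ℝ) : ℝ :=
  (2 * α + 1) / (4 * α + 1) ^ (1 + 1 / (2 * α)) * L ^ (-(1 / (2 * α)))

/-- The bandwidth `T = ⌊C_T φ^{-1/α}⌋`. -/
def bandT (α L φ : ℝ) : ℕ := ⌊constT α L * φ ^ (-(1 / α))⌋₊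

/-- `λ = C_λ φ^{(2α+1)/α}`. -/
def lam (α L φ : ℝ) : ℝ := constLam α L * φ ^ ((2 * α + 1) / α)

/-- `b(φ) = C^{1/2} φ^{2 + 1/(2α)}`. -/
def bFun (α L φ : ℝ) : ℝ := Real.sqrt (constC α L) * φ ^ (2 + 1 / (2 * α))

/-- The weight `w*_{ij} = λ / (2b) (1 - (|i-j|/T)^{2α})_+`. The weights vanish for `|i-j| > T`;
the case distinction only matters when `T = 0`, where a division by zero would occur. -/
def weight {p : ℕ} (α L φ : ℝ) (i j : Fin p) : ℝ :=
  if idxDist i j ≤ (bandT α L φ : ℝ) then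
    lam α L φ / (2 * bFun α L φ) * max (1 - (idxDist i j / (bandT α L φ : ℝ)) ^ (2 * α)) 0
  else 0

/-- The weighted U-statistic `D̂_n`. -/
def statD (n p : ℕ) (α L φ : ℝ) (x : Sample n p) : ℝ :=
  1 / ((n : ℝ) * ((n : ℝ) - 1) * (p : ℝ)) *
    ∑ k, ∑ l with l ≠ k, ∑ i, ∑ j ∈ Finset.Ioi i,
      weight α L φ i j * x k i * x k j * x l i * x l j

theorem measurable_statD (n p : ℕ) (α L φ : ℝ) : Measurable (statD n p α L φ) := by
  unfold statD
  fun_prop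

/-- A test procedure: a measurable function of the observations with values in `[0, 1]`. -/
structure TestProcedure (n p : ℕ) where
  toFun : Sample n p → ℝ
  measurable_toFun : Measurable toFun
  mem_unit : ∀ x, toFun x ∈ Set.Icc (0 : ℝ) 1

/-- The type I error `η(Δ) = E_I(Δ)`. -/
def typeI {n p : ℕ} (Δ : TestProcedure n p) : ℝ≥0∞ :=
  ∫⁻ x, ENNReal.ofReal (Δ.toFun x) ∂(sampleLaw n p 1)

/-- The maximal type II error `β(Δ, Q) = sup_{Σ ∈ Q} E_Σ(1 - Δ)`. -/
def typeII {n p : ℕ} (Δ : TestProcedure n p) (Q : Set (Matrix (Fin p) (Fin p) ℝ)) : ℝ≥0∞ :=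
  ⨆ S ∈ Q, ∫⁻ x, ENNReal.ofReal (1 - Δ.toFun x) ∂(sampleLaw n p S)

/-- The total error `γ(Δ, Q) = η(Δ) + β(Δ, Q)`. -/
def totalError {n p : ℕ} (Δ : TestProcedure n p) (Q : Set (Matrix (Fin p) (Fin p) ℝ)) : ℝ≥0∞ :=
  typeI Δ + typeII Δ Q

/-- The test `Δ*(t) = 1(D̂_n > t)`. -/
def starTest (n p : ℕ) (α L φ t : ℝ) : TestProcedure n p where
  toFun := Set.indicator {x | t < statD n p α L φ x} fun _ => 1
  measurable_toFun :=
    measurable_const.indicator (measurableSet_lt measurable_const (measurable_statD n p α L φ))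
  mem_unit x := by
    by_cases h : x ∈ {x | t < statD n p α L φ x} <;> simp [Set.indicator, h]

end CovTest

end

/-!
The argument is Chebyshev's inequality, applied to the Hoeffding decomposition of the statistic.

**Variance.** Put `Z_{ij}(y) = y_i y_j - S_{ij}`. The Hoeffding decomposition (`statD_sub_eq`) writes
`D̂_n - E` as a linear part `∑_k ∑_{ij} w_{ij} S_{ij} Z_{ij}(X_k)` plus a degenerate U-statistic with
kernel `∑_{ij} w_{ij} Z_{ij}(y) Z_{ij}(y')`, where `E = (1/p) ∑_{i<j} w_{ij} S_{ij}²`. Independence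
reduces the second moments of both parts to the covariances of the `Z_{ij}`, which Isserlis' formula
(`integral_coord_mul_four`) gives as `S_{ii'} S_{jj'} + S_{ij'} S_{ji'}`.

**Bounds.** Let `M = λ/(2b)` be the height of the weights and `R = ∑_{i≠j} S_{ij}²`, and split off
the unit diagonal, `S = 1 + ρ`. The linear part is at most a constant times
`(1 + ‖ρ‖_F²) ‖(w_{ij} S_{ij})‖_F² ≤ (1 + R) M p E` (`sum_quadratic_form_le`), the degenerate part
at most a constant times `M² T p + M² T R + M² R²` (`sum_weight_cov_sq_le`). Moreover `M² T` is
bounded by a constant for every `φ > 0`, which already settles the type I error, where `E = R = 0`.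

**Signal.** On the alternative, `w_{ij} ≥ M (1 - (|i-j|/T)^{2α})` and the smoothness condition yield
`E ≥ M (1 - θ) R / (2p)` for any fixed `θ > 1/(4α+1)` and small `φ` (`le_signal`). This has two
consequences. As `R/(2p) ≥ φ²` and `M φ² · 4α/(4α+1) = b(φ)`, the mean `E` exceeds `κ b(φ)` for
any fixed `κ < 1`, hence exceeds the threshold by a fixed proportion. And `M R ≤ C p E`, so that
after division by `E²` the terms quadratic in `R` contribute only `1/n` and `1/n²`; the remaining
ones are bounded through `n² p b² → ∞` and `R ≤ 2 p L`.
-/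

noncomputable section

namespace CovTest

open scoped NNReal

/-! ### Fourth moments of Gaussian vectors -/

section Gaussian

/-- The fourth moment is read off the fourth derivative of the moment generating function
`exp (v t² / 2)` at `0`. -/
theorem integral_pow_four_gaussianReal (v : ℝ≥0) :
    ∫ x, x ^ 4 ∂(gaussianReal 0 v) = 3 * (v : ℝ) ^ 2 := by
  have h0 : iteratedDeriv 4 (mgf id (gaussianReal 0 v)) 0 = ∫ x, x ^ 4 ∂(gaussianReal 0 v) := by
    rw [iteratedDeriv_mgf_zero]
    · rfl
    · simp [integrableExpSet_id_gaussianReal]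
  rw [← h0, mgf_id_gaussianReal]
  -- each derivative is a polynomial times `e`; the fourth is only needed at `0`
  set e : ℝ → ℝ := fun t => Real.exp (0 * t + v * t ^ 2 / 2) with he
  have hd : ∀ t, HasDerivAt e (v * t * e t) t := by
    intro t
    have h1 : HasDerivAt (fun t : ℝ => 0 * t + v * t ^ 2 / 2) (v * t) t := by
      have := (((hasDerivAt_id t).const_mul 0).add
        ((((hasDerivAt_id t).pow 2).const_mul (v : ℝ)).div_const 2))
      convert! this using 1
      simp; ring
    have := h1.exp
    rw [mul_comm]
    exact this
  have d1 : deriv e = fun t => v * t * e t := funext fun t => (hd t).deriv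
  have d2 : deriv (fun t => v * t * e t) = fun t => (v + v ^ 2 * t ^ 2) * e t := by
    funext t
    have := (((hasDerivAt_id t).const_mul (v : ℝ)).mul (hd t)).deriv
    simp only [id] at this
    refine Eq.trans this ?_
    ring
  have d3 : deriv (fun t => (v + v ^ 2 * t ^ 2) * e t)
      = fun t => (3 * v ^ 2 * t + v ^ 3 * t ^ 3) * e t := by
    funext t
    have := (((((hasDerivAt_id t).pow 2).const_mul ((v : ℝ) ^ 2)).const_add (v : ℝ)).mul
      (hd t)).deriv
    simp only [id] at this
    refine Eq.trans this ?_
    simp; ring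
  have d4 : deriv (fun t => (3 * v ^ 2 * t + v ^ 3 * t ^ 3) * e t) 0 = 3 * (v : ℝ) ^ 2 := by
    have := (((((hasDerivAt_id (0:ℝ)).const_mul (3 * (v : ℝ) ^ 2)).add
      ((((hasDerivAt_id (0:ℝ)).pow 3).const_mul ((v : ℝ) ^ 3))))).mul (hd 0)).deriv
    simp only [id] at this
    refine Eq.trans this ?_
    simp [he]
  rw [iteratedDeriv_succ, iteratedDeriv_succ, iteratedDeriv_succ, iteratedDeriv_one, d1, d2, d3, d4]

variable {p : ℕ} {S : Matrix (Fin p) (Fin p) ℝ}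

theorem memLp_coord (i : Fin p) (q : ℝ≥0∞) (hq : q ≠ ∞) :
    MemLp (fun x : EuclideanSpace ℝ (Fin p) => x i) q
      (multivariateGaussian (0 : EuclideanSpace ℝ (Fin p)) S) := by
  exact IsGaussian.memLp_dual _ (EuclideanSpace.proj i) q hq

theorem memLp_coord_mul (i j : Fin p) :
    MemLp (fun x : EuclideanSpace ℝ (Fin p) => x i * x j) 2
      (multivariateGaussian (0 : EuclideanSpace ℝ (Fin p)) S) := by
  have : ENNReal.HolderTriple 4 4 2 := ⟨by
    rw [← two_mul, show (4 : ℝ≥0∞) = 2 * 2 by norm_num, ENNReal.mul_inv (by simp) (by simp),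
      ← mul_assoc, ENNReal.mul_inv_cancel (by simp) (by simp), one_mul]⟩
  exact (memLp_coord j 4 (by simp)).mul (memLp_coord i 4 (by simp))

theorem integrable_coord_mul_four (i j k l : Fin p) :
    Integrable (fun x : EuclideanSpace ℝ (Fin p) => x i * x j * (x k * x l))
      (multivariateGaussian (0 : EuclideanSpace ℝ (Fin p)) S) :=
  (memLp_coord_mul i j).integrable_mul (memLp_coord_mul k l)

theorem integral_coord (i : Fin p) :
    ∫ x : EuclideanSpace ℝ (Fin p), x i
      ∂(multivariateGaussian (0 : EuclideanSpace ℝ (Fin p)) S) = 0 := by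
  have h := (EuclideanSpace.proj i : StrongDual ℝ (EuclideanSpace ℝ (Fin p))).integral_comp_comm
    (IsGaussian.integrable_fun_id (μ := multivariateGaussian (0 : EuclideanSpace ℝ (Fin p)) S))
  simpa using h

theorem integral_coord_mul (hS : S.PosSemidef) (i j : Fin p) :
    ∫ x : EuclideanSpace ℝ (Fin p), x i * x j
      ∂(multivariateGaussian (0 : EuclideanSpace ℝ (Fin p)) S) = S i j := by
  have h := covariance_eval_multivariateGaussian (μ := (0 : EuclideanSpace ℝ (Fin p))) hS i j
  rw [covariance_eq_sub (memLp_coord i 2 (by simp)) (memLp_coord j 2 (by simp))] at h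
  simpa [integral_coord] using h

/-- A linear form in a centred Gaussian vector is centred Gaussian, so that its fourth moment is
three times the square of its variance. -/
theorem integral_dual_pow_four (f : StrongDual ℝ (EuclideanSpace ℝ (Fin p))) :
    ∫ x, f x ^ 4 ∂(multivariateGaussian (0 : EuclideanSpace ℝ (Fin p)) S)
      = 3 * (∫ x, f x ^ 2 ∂(multivariateGaussian (0 : EuclideanSpace ℝ (Fin p)) S)) ^ 2 := by
  set ν := multivariateGaussian (0 : EuclideanSpace ℝ (Fin p)) S with hν
  have hm : ∫ x, f x ∂ν = 0 := by
    have h := f.integral_comp_comm (IsGaussian.integrable_fun_id (μ := ν))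
    simpa [hν] using h
  have hv : Var[f; ν] = ∫ x, f x ^ 2 ∂ν :=
    variance_of_integral_eq_zero f.continuous.aemeasurable hm
  have hmap := IsGaussian.map_eq_gaussianReal (μ := ν) f
  rw [hm] at hmap
  have h4 := integral_pow_four_gaussianReal (Var[f; ν]).toNNReal
  rw [← hmap, integral_map f.continuous.aemeasurable (by fun_prop),
    Real.coe_toNNReal _ (variance_nonneg _ _), hv] at h4
  exact h4

/-- **Isserlis' formula** for four coordinates of a centred Gaussian vector, obtained from the
fourth moments of linear forms by polarization. -/
theorem integral_coord_mul_four (hS : S.PosSemidef) (i j k l : Fin p) :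
    ∫ x : EuclideanSpace ℝ (Fin p), x i * x j * (x k * x l)
      ∂(multivariateGaussian (0 : EuclideanSpace ℝ (Fin p)) S)
      = S i j * S k l + S i k * S j l + S i l * S j k := by
  set ν := multivariateGaussian (0 : EuclideanSpace ℝ (Fin p)) S with hν
  let f (a b c : ℝ) : StrongDual ℝ (EuclideanSpace ℝ (Fin p)) :=
    EuclideanSpace.proj i + a • EuclideanSpace.proj j + b • EuclideanSpace.proj k
      + c • EuclideanSpace.proj l
  have hf (a b c : ℝ) (x : EuclideanSpace ℝ (Fin p)) :
      f a b c x = x i + a * x j + b * x k + c * x l := by simp [f]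
  have hint (u v : Fin p) : Integrable (fun x : EuclideanSpace ℝ (Fin p) => x u * x v) ν :=
    (memLp_coord_mul u v).integrable (by norm_num)
  have h2 (a b c : ℝ) : ∫ x, f a b c x ^ 2 ∂ν = S i i + a ^ 2 * S j j + b ^ 2 * S k k
      + c ^ 2 * S l l + 2 * a * S i j + 2 * b * S i k + 2 * c * S i l + 2 * (a * b) * S j k
      + 2 * (a * c) * S j l + 2 * (b * c) * S k l := by
    have e : (fun x => f a b c x ^ 2) = fun x : EuclideanSpace ℝ (Fin p) =>
        x i * x i + a ^ 2 * (x j * x j) + b ^ 2 * (x k * x k)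
      + c ^ 2 * (x l * x l) + 2 * a * (x i * x j) + 2 * b * (x i * x k) + 2 * c * (x i * x l)
      + 2 * (a * b) * (x j * x k)
      + 2 * (a * c) * (x j * x l) + 2 * (b * c) * (x k * x l) := by
      funext x; rw [hf]; ring
    have hc (r : ℝ) (u v : Fin p) :
        Integrable (fun x : EuclideanSpace ℝ (Fin p) => r * (x u * x v)) ν := (hint u v).const_mul r
    rw [e, integral_add, integral_add, integral_add, integral_add, integral_add, integral_add,
      integral_add, integral_add, integral_add]
    · simp only [integral_const_mul, integral_coord_mul hS, hν]
    all_goals fun_prop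
  have h4 (a b c : ℝ) := integral_dual_pow_four (S := S) (f a b c)
  have hI (a b c : ℝ) : Integrable (fun x => f a b c x ^ 4) ν := by
    have := (IsGaussian.memLp_dual ν (f a b c) 4 (by simp)).integrable_norm_pow (by norm_num)
    refine this.congr (Eventually.of_forall fun x => ?_)
    simp only [Real.norm_eq_abs]
    rw [Even.pow_abs (by decide)]
  -- polarization: `192 a b c d` is the signed sum of `(a ± b ± c ± d)⁴` over the eight sign patterns
  have key : (fun x : EuclideanSpace ℝ (Fin p) => x i * x j * (x k * x l)) = fun x =>
      192⁻¹ * (f 1 1 1 x ^ 4 - f (-1) 1 1 x ^ 4 - f 1 (-1) 1 x ^ 4 - f 1 1 (-1) x ^ 4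
        + f (-1) (-1) 1 x ^ 4 + f (-1) 1 (-1) x ^ 4 + f 1 (-1) (-1) x ^ 4
        - f (-1) (-1) (-1) x ^ 4) := by
    funext x; simp only [hf]; ring
  rw [key, integral_const_mul, integral_sub, integral_add, integral_add, integral_add, integral_sub,
    integral_sub, integral_sub]
  · rw [← hν] at h4
    simp only [h4, h2]
    ring
  all_goals fun_prop

end Gaussian

/-! ### Second moments of U-statistics -/

/-- The kernel `(y, y') ↦ ∑ q, w q Z_q(y) Z_q(y')` of a weighted U-statistic. -/
def uKernel {E Q : Type*} [Fintype Q] (w : Q → ℝ) (Z : Q → E → ℝ) (y y' : E) : ℝ := ∑ q, w q * Z q y * Z q y'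

theorem uKernel_comm {E Q : Type*} [Fintype Q] (w : Q → ℝ) (Z : Q → E → ℝ) (y y' : E) :
    uKernel w Z y y' = uKernel w Z y' y := by
  unfold uKernel
  exact Finset.sum_congr rfl fun q _ => by ring

/-- The product of the values of four functions at four (possibly equal) coordinates, gathered
coordinate by coordinate. -/
theorem prod_gather_four {E : Type*} {n : ℕ} (a b c d : E → ℝ) (k l k' l' : Fin n) (x : Fin n → E) :
    ∏ i, ((if i = k then a (x i) else 1) * (if i = l then b (x i) else 1) *
      ((if i = k' then c (x i) else 1) * (if i = l' then d (x i) else 1)))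
      = a (x k) * b (x l) * (c (x k') * d (x l')) := by
  simp only [Finset.prod_mul_distrib, Finset.prod_ite_eq', Finset.mem_univ, if_true]

section UStatistic

variable {E Q : Type*} [MeasurableSpace E] [Fintype Q] {n : ℕ} {ν : Measure E}
  [IsProbabilityMeasure ν]

theorem integral_eval_mul_four (a b c d : E → ℝ) (k l k' l' : Fin n) :
    ∫ x : Fin n → E, a (x k) * b (x l) * (c (x k') * d (x l')) ∂(Measure.pi fun _ => ν)
      = ∏ i, ∫ y, ((if i = k then a y else 1) * (if i = l then b y else 1) *
      ((if i = k' then c y else 1) * (if i = l' then d y else 1))) ∂ν := by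
  rw [← integral_fintype_prod_eq_prod]
  simp only [prod_gather_four]

theorem integral_eval_mul_four_eq_zero {a b c d : E → ℝ} {k l k' l' : Fin n} (hl : k ≠ l)
    (hk' : k ≠ k') (hl' : k ≠ l') (ha : ∫ y, a y ∂ν = 0) :
    ∫ x : Fin n → E, a (x k) * b (x l) * (c (x k') * d (x l')) ∂(Measure.pi fun _ => ν) = 0 := by
  rw [integral_eval_mul_four]
  refine Finset.prod_eq_zero (Finset.mem_univ k) ?_
  simpa [hl, hk', hl'] using ha

theorem integral_eval_mul_eval (f g : E → ℝ) {k l : Fin n} (hkl : k ≠ l) :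
    ∫ x : Fin n → E, f (x k) * g (x l) ∂(Measure.pi fun _ => ν) = (∫ y, f y ∂ν) * ∫ y, g y ∂ν := by
  have h := integral_eval_mul_four (ν := ν) f g (fun _ => 1) (fun _ => 1) k l k k
  simp only [mul_one, ite_self] at h
  rw [h, Finset.prod_eq_mul k l hkl]
  · simp [hkl, hkl.symm]
  · intro c _ hc
    simp [hc.1, hc.2]
  · simp
  · simp

theorem integrable_eval_mul_eval {f g : E → ℝ} (hf : Integrable f ν) (hg : Integrable g ν)
    {k l : Fin n} (hkl : k ≠ l) :
    Integrable (fun x : Fin n → E => f (x k) * g (x l)) (Measure.pi fun _ => ν) := by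
  have h := Integrable.fintype_prod (μ := fun _ : Fin n => ν)
    (f := fun i y => (if i = k then f y else 1) * (if i = l then g y else 1)) (by
      intro i
      by_cases h1 : i = k
      · have : i ≠ l := fun h => hkl (h1.symm.trans h)
        simpa [h1, hkl] using hf
      · by_cases h2 : i = l
        · simpa [h1, h2, hkl.symm] using hg
        · simp [h1, h2])
  simpa only [Finset.prod_mul_distrib, Finset.prod_ite_eq', Finset.mem_univ, if_true] using h

theorem memLp_eval_mul_eval {f g : E → ℝ} (hf : MemLp f 2 ν) (hg : MemLp g 2 ν)
    {k l : Fin n} (hkl : k ≠ l) :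
    MemLp (fun x : Fin n → E => f (x k) * g (x l)) 2 (Measure.pi fun _ => ν) := by
  have hi := integrable_eval_mul_eval (hf.integrable one_le_two) (hg.integrable one_le_two) hkl
  rw [memLp_two_iff_integrable_sq hi.aestronglyMeasurable]
  simpa only [mul_pow] using integrable_eval_mul_eval hf.integrable_sq hg.integrable_sq hkl

/-- The second moment of a sum of independent centred variables. -/
theorem integral_sq_sum_eval {g : E → ℝ} (hg : MemLp g 2 ν) (hg0 : ∫ y, g y ∂ν = 0) :
    ∫ x : Fin n → E, (∑ k, g (x k)) ^ 2 ∂(Measure.pi fun _ => ν) = n * ∫ y, g y ^ 2 ∂ν := by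
  have hL (k : Fin n) : MemLp (fun x : Fin n → E => g (x k)) 2 (Measure.pi fun _ => ν) :=
    hg.comp_measurePreserving (measurePreserving_eval _ k)
  have hint (k l : Fin n) :
      Integrable (fun x : Fin n → E => g (x k) * g (x l)) (Measure.pi fun _ => ν) :=
    (hL k).integrable_mul (hL l)
  have hI (k l : Fin n) : ∫ x : Fin n → E, g (x k) * g (x l) ∂(Measure.pi fun _ => ν)
      = if k = l then ∫ y, g y ^ 2 ∂ν else 0 := by
    split_ifs with h
    · subst h
      have := integral_comp_eval (μ := fun _ : Fin n => ν) (i := k)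
        (f := fun y => g y ^ 2) (hg.aestronglyMeasurable.pow 2)
      simpa only [← sq] using this
    · rw [integral_eval_mul_eval g g h, hg0, zero_mul]
  simp_rw [sq (∑ k, g _), Finset.sum_mul_sum]
  rw [integral_finsetSum _ fun k _ => integrable_finsetSum _ fun l _ => hint k l]
  simp_rw [integral_finsetSum _ fun l _ => hint _ l, hI]
  simp

variable {w : Q → ℝ} {Z : Q → E → ℝ}

theorem memLp_uKernel (hZ : ∀ q, MemLp (Z q) 2 ν) {k l : Fin n} (hkl : k ≠ l) :
    MemLp (fun x : Fin n → E => uKernel w Z (x k) (x l)) 2 (Measure.pi fun _ => ν) := by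
  unfold uKernel
  refine memLp_finsetSum _ fun q _ => ?_
  simpa only [mul_assoc] using (memLp_eval_mul_eval (hZ q) (hZ q) hkl).const_mul (w q)

theorem integral_uKernel_mul (hZ : ∀ q, MemLp (Z q) 2 ν) {k l k' l' : Fin n} (hkl : k ≠ l)
    (hkl' : k' ≠ l') :
    ∫ x : Fin n → E, uKernel w Z (x k) (x l) * uKernel w Z (x k') (x l') ∂(Measure.pi fun _ => ν)
      = ∑ q, ∑ q', w q * w q' * ∫ x : Fin n → E, Z q (x k) * Z q (x l) *
        (Z q' (x k') * Z q' (x l')) ∂(Measure.pi fun _ => ν) := by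
  have hint (q q' : Q) : Integrable (fun x : Fin n → E => w q * w q' * (Z q (x k) * Z q (x l) *
        (Z q' (x k') * Z q' (x l')))) (Measure.pi fun _ => ν) :=
    ((memLp_eval_mul_eval (hZ q) (hZ q) hkl).integrable_mul
      (memLp_eval_mul_eval (hZ q') (hZ q') hkl')).const_mul _
  have e (x : Fin n → E) : uKernel w Z (x k) (x l) * uKernel w Z (x k') (x l')
      = ∑ q, ∑ q', w q * w q' * (Z q (x k) * Z q (x l) * (Z q' (x k') * Z q' (x l'))) := by
    unfold uKernel
    rw [Finset.sum_mul_sum]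
    exact Finset.sum_congr rfl fun q _ => Finset.sum_congr rfl fun q' _ => by ring
  simp_rw [e]
  rw [integral_finsetSum _ fun k _ => integrable_finsetSum _ fun l _ => hint k l]
  simp_rw [integral_finsetSum _ fun l _ => hint _ l, integral_const_mul]

theorem integral_uKernel_mul_self (hZ : ∀ q, MemLp (Z q) 2 ν) {k l : Fin n} (hkl : k ≠ l) :
    ∫ x : Fin n → E, uKernel w Z (x k) (x l) * uKernel w Z (x k) (x l) ∂(Measure.pi fun _ => ν)
      = ∑ q, ∑ q', w q * w q' * (∫ y, Z q y * Z q' y ∂ν) ^ 2 := by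
  rw [integral_uKernel_mul hZ hkl hkl]
  refine Finset.sum_congr rfl fun q _ => Finset.sum_congr rfl fun q' _ => ?_
  have := integral_eval_mul_eval (ν := ν) (fun y => Z q y * Z q' y) (fun y => Z q y * Z q' y) hkl
  rw [sq, ← this]
  congr 2
  funext x
  ring

theorem integral_uKernel_mul_eq_zero (hZ : ∀ q, MemLp (Z q) 2 ν) (hZ0 : ∀ q, ∫ y, Z q y ∂ν = 0)
    {k l k' l' : Fin n} (hkl : k ≠ l) (hkl' : k' ≠ l') (h1 : k ≠ k') (h2 : k ≠ l') :
    ∫ x : Fin n → E, uKernel w Z (x k) (x l) * uKernel w Z (x k') (x l') ∂(Measure.pi fun _ => ν)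
      = 0 := by
  rw [integral_uKernel_mul hZ hkl hkl']
  refine Finset.sum_eq_zero fun q _ => Finset.sum_eq_zero fun q' _ => ?_
  rw [integral_eval_mul_four_eq_zero hkl h1 h2 (hZ0 q), mul_zero]

/-- The second moment of a degenerate U-statistic: only the pairs `(k, l)` and `(l, k)` are
correlated with the pair `(k, l)`. -/
theorem integral_sq_sum_uKernel (hZ : ∀ q, MemLp (Z q) 2 ν) (hZ0 : ∀ q, ∫ y, Z q y ∂ν = 0) :
    ∫ x : Fin n → E, (∑ k, ∑ l with l ≠ k, uKernel w Z (x k) (x l)) ^ 2 ∂(Measure.pi fun _ => ν)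
      = 2 * (n * (n - 1)) * ∑ q, ∑ q', w q * w q' * (∫ y, Z q y * Z q' y ∂ν) ^ 2 := by
  set τ := ∑ q, ∑ q', w q * w q' * (∫ y, Z q y * Z q' y ∂ν) ^ 2 with hτ
  set A : Finset (Fin n × Fin n) := Finset.univ.offDiag with hA
  have hAm (a : Fin n × Fin n) : a ∈ A ↔ a.1 ≠ a.2 := by simp [hA]
  have hsum (x : Fin n → E) : ∑ k, ∑ l with l ≠ k, uKernel w Z (x k) (x l)
      = ∑ a ∈ A, uKernel w Z (x a.1) (x a.2) := by
    rw [Finset.sum_sigma']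
    refine Finset.sum_bij' (fun a _ => (a.1, a.2)) (fun a _ => ⟨a.1, a.2⟩) ?_ ?_ ?_ ?_ ?_ <;>
      simp +contextual [hA, eq_comm]
  have hint (a b : Fin n × Fin n) (ha : a ∈ A) (hb : b ∈ A) : Integrable (fun x : Fin n → E =>
      uKernel w Z (x a.1) (x a.2) * uKernel w Z (x b.1) (x b.2)) (Measure.pi fun _ => ν) :=
    (memLp_uKernel hZ ((hAm a).1 ha)).integrable_mul (memLp_uKernel hZ ((hAm b).1 hb))
  have hI (a b : Fin n × Fin n) (ha : a ∈ A) (hb : b ∈ A) :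
      ∫ x : Fin n → E, uKernel w Z (x a.1) (x a.2) * uKernel w Z (x b.1) (x b.2)
        ∂(Measure.pi fun _ => ν) = (if b = a then τ else 0) + if b = a.swap then τ else 0 := by
    obtain ⟨k, l⟩ := a
    obtain ⟨k', l'⟩ := b
    have hkl : k ≠ l := (hAm _).1 ha
    have hkl' : k' ≠ l' := (hAm _).1 hb
    simp only [Prod.mk.injEq, Prod.swap_prod_mk]
    by_cases h1 : k = k'
    · subst h1
      by_cases h2 : l = l'
      · subst h2
        rw [integral_uKernel_mul_self hZ hkl]
        simp [hkl, hτ]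
      · rw [if_neg (by tauto), if_neg (by tauto), add_zero]
        have := integral_uKernel_mul_eq_zero (w := w) hZ hZ0 hkl.symm hkl' hkl.symm h2
        refine Eq.trans ?_ this
        congr 1
        funext x
        rw [uKernel_comm w Z (x k) (x l)]
    · by_cases h2 : k = l'
      · subst h2
        by_cases h3 : l = k'
        · subst h3
          rw [if_neg (by tauto), if_pos ⟨rfl, rfl⟩, zero_add, hτ,
            ← integral_uKernel_mul_self hZ hkl]
          congr 1
          funext x
          rw [uKernel_comm w Z (x l) (x k)]
        · rw [if_neg (by tauto), if_neg (by tauto), add_zero]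
          have := integral_uKernel_mul_eq_zero (w := w) hZ hZ0 hkl.symm hkl' h3 hkl.symm
          refine Eq.trans ?_ this
          congr 1
          funext x
          rw [uKernel_comm w Z (x k) (x l)]
      · rw [integral_uKernel_mul_eq_zero hZ hZ0 hkl hkl' h1 h2,
          if_neg (by tauto), if_neg (by tauto), add_zero]
  simp_rw [hsum, sq, Finset.sum_mul_sum]
  rw [integral_finsetSum _ fun a ha => integrable_finsetSum _ fun b hb => hint a b ha hb]
  have hrow (a : Fin n × Fin n) (ha : a ∈ A) :
      ∫ x : Fin n → E, ∑ b ∈ A, uKernel w Z (x a.1) (x a.2) * uKernel w Z (x b.1) (x b.2)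
        ∂(Measure.pi fun _ => ν) = 2 * τ := by
    rw [integral_finsetSum _ fun b hb => hint a b ha hb,
      Finset.sum_congr rfl fun b hb => hI a b ha hb, Finset.sum_add_distrib,
      Finset.sum_ite_eq', Finset.sum_ite_eq', if_pos ha, if_pos, two_mul]
    rw [hAm] at ha ⊢
    exact ha.symm
  rw [Finset.sum_congr rfl hrow, Finset.sum_const, hA, Finset.offDiag_card, Finset.card_univ,
    Fintype.card_fin, nsmul_eq_mul, Nat.cast_sub (Nat.le_mul_self n)]
  push_cast
  ring

end UStatistic

/-! ### Finite sums weighted by a covariance matrix -/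

/-- The squares of the off-diagonal entries of a matrix; the diagonal is set to zero. -/
def offSq {ι : Type*} [DecidableEq ι] (S : Matrix ι ι ℝ) (i j : ι) : ℝ :=
  if i = j then 0 else S i j ^ 2

theorem offSq_nonneg {ι : Type*} [DecidableEq ι] (S : Matrix ι ι ℝ) (i j : ι) :
    0 ≤ offSq S i j := by
  unfold offSq; split_ifs <;> positivity

theorem sq_eq_offSq_add {ι : Type*} [DecidableEq ι] {S : Matrix ι ι ℝ}
    (hd : ∀ i, S i i = 1) (i j : ι) :
    S i j ^ 2 = (if i = j then 1 else 0) + offSq S i j := by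
  unfold offSq
  split_ifs with h
  · subst h; simp [hd]
  · simp

section FiniteSums

variable {ι : Type*} [Fintype ι]

/-- The squared Frobenius norm. -/
def frobSq (A : Matrix ι ι ℝ) : ℝ := ∑ i, ∑ j, A i j ^ 2

theorem frobSq_nonneg (A : Matrix ι ι ℝ) : 0 ≤ frobSq A :=
  Finset.sum_nonneg fun _ _ => Finset.sum_nonneg fun _ _ => sq_nonneg _

theorem frobSq_transpose (A : Matrix ι ι ℝ) : frobSq A.transpose = frobSq A :=
  Finset.sum_comm

theorem frobSq_add_le (A B : Matrix ι ι ℝ) : frobSq (A + B) ≤ 2 * frobSq A + 2 * frobSq B := by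
  unfold frobSq
  simp_rw [Finset.mul_sum, ← Finset.sum_add_distrib]
  refine Finset.sum_le_sum fun i _ => Finset.sum_le_sum fun j _ => ?_
  rw [Matrix.add_apply]
  nlinarith [sq_nonneg (A i j - B i j)]

theorem frobSq_mul_le (A B : Matrix ι ι ℝ) : frobSq (A * B) ≤ frobSq A * frobSq B := by
  have h : frobSq A * frobSq B = ∑ i, ∑ j, (∑ k, A i k ^ 2) * ∑ k, B k j ^ 2 := by
    rw [frobSq, frobSq, Finset.sum_comm (f := fun i j => B i j ^ 2), Finset.sum_mul_sum]
  rw [h]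
  exact Finset.sum_le_sum fun i _ => Finset.sum_le_sum fun j _ =>
    Finset.sum_mul_sq_le_sq_mul_sq _ (fun k => A i k) fun k => B k j

theorem sum_mul_le_frobSq (A B : Matrix ι ι ℝ) :
    (∑ i, ∑ j, A i j * B i j) ^ 2 ≤ frobSq A * frobSq B := by
  unfold frobSq
  simp_rw [← Finset.sum_product']
  exact Finset.sum_mul_sq_le_sq_mul_sq _ (fun a : ι × ι => A a.1 a.2) fun a => B a.1 a.2

variable [DecidableEq ι]

/-- The sum of the squares of the off-diagonal entries. -/
def offEnergy (S : Matrix ι ι ℝ) : ℝ := ∑ i, ∑ j, offSq S i j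

theorem offEnergy_nonneg (S : Matrix ι ι ℝ) : 0 ≤ offEnergy S :=
  Finset.sum_nonneg fun _ _ => Finset.sum_nonneg fun _ _ => offSq_nonneg _ _ _

theorem offEnergy_one : offEnergy (1 : Matrix ι ι ℝ) = 0 := by
  refine Finset.sum_eq_zero fun i _ => Finset.sum_eq_zero fun j _ => ?_
  unfold offSq
  split_ifs with h <;> simp [h]

variable {S : Matrix ι ι ℝ}

theorem frobSq_sub_one (hd : ∀ i, S i i = 1) : frobSq (S - 1) = offEnergy S := by
  refine Finset.sum_congr rfl fun i _ => Finset.sum_congr rfl fun j _ => ?_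
  unfold offSq
  split_ifs with h
  · subst h; simp [hd]
  · simp [h]

/-- Splitting off the unit diagonal: the operator norm of `S` is replaced by the Frobenius norm of
its off-diagonal part. -/
theorem frobSq_mul_le_of_diag (hd : ∀ i, S i i = 1) (A : Matrix ι ι ℝ) :
    frobSq (S * A) ≤ 2 * (1 + offEnergy S) * frobSq A := by
  have h : S * A = A + (S - 1) * A := by rw [sub_mul, one_mul]; abel
  have h1 := frobSq_add_le A ((S - 1) * A)
  have h2 := frobSq_mul_le (S - 1) A
  rw [frobSq_sub_one hd] at h2
  rw [h]
  linarith

theorem frobSq_sandwich_le (hs : S.IsSymm) (hd : ∀ i, S i i = 1) (A : Matrix ι ι ℝ) :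
    frobSq (S * A * S) ≤ (2 * (1 + offEnergy S)) ^ 2 * frobSq A := by
  have h : (S * A * S).transpose = S * (S * A).transpose := by
    rw [Matrix.transpose_mul, hs.eq]
  rw [← frobSq_transpose, h]
  have h1 := frobSq_mul_le_of_diag hd (S * A).transpose
  rw [frobSq_transpose] at h1
  have h2 := frobSq_mul_le_of_diag hd A
  have h3 : 0 ≤ 2 * (1 + offEnergy S) := by linarith [offEnergy_nonneg S]
  nlinarith [mul_le_mul_of_nonneg_left h2 h3]

theorem sum_mul_sandwich_le (hs : S.IsSymm) (hd : ∀ i, S i i = 1) (A B : Matrix ι ι ℝ)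
    (hB : frobSq B = frobSq A) :
    ∑ i, ∑ j, A i j * (S * B * S) i j ≤ 2 * (1 + offEnergy S) * frobSq A := by
  have h0 : 0 ≤ 2 * (1 + offEnergy S) := by linarith [offEnergy_nonneg S]
  refine le_of_sq_le_sq ?_ (mul_nonneg h0 (frobSq_nonneg A))
  refine (sum_mul_le_frobSq _ _).trans ?_
  have h := frobSq_sandwich_le hs hd B
  rw [hB] at h
  nlinarith [mul_le_mul_of_nonneg_left h (frobSq_nonneg A)]

/-- A bound for the variance of the quadratic form `∑ a i j X_i X_j` of a Gaussian vector with
covariance matrix `S`, which equals `⟨a, S a S⟩ + ⟨a, S aᵀ S⟩`. -/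
theorem sum_quadratic_form_le (hs : S.IsSymm) (hd : ∀ i, S i i = 1) (a : Matrix ι ι ℝ) :
    ∑ q : ι × ι, ∑ q' : ι × ι, a q.1 q.2 * a q'.1 q'.2 *
      (S q.1 q'.1 * S q.2 q'.2 + S q.1 q'.2 * S q.2 q'.1) ≤ 4 * (1 + offEnergy S) * frobSq a := by
  have h1 := sum_mul_sandwich_le hs hd a a rfl
  have h2 := sum_mul_sandwich_le hs hd a a.transpose (frobSq_transpose a)
  have e : ∑ q : ι × ι, ∑ q' : ι × ι, a q.1 q.2 * a q'.1 q'.2 *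
      (S q.1 q'.1 * S q.2 q'.2 + S q.1 q'.2 * S q.2 q'.1)
      = ∑ i, ∑ j, a i j * (S * a * S) i j + ∑ i, ∑ j, a i j * (S * a.transpose * S) i j := by
    simp only [Fintype.sum_prod_type, Matrix.mul_apply, Finset.mul_sum, Finset.sum_mul,
      ← Finset.sum_add_distrib, Matrix.transpose_apply]
    refine Finset.sum_congr rfl fun i _ => Finset.sum_congr rfl fun j _ => ?_
    simp only [mul_add, Finset.sum_add_distrib]
    congr 1
    · rw [Finset.sum_comm]
      refine Finset.sum_congr rfl fun k _ => Finset.sum_congr rfl fun l _ => ?_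
      rw [hs.apply j k]
      ring
    · refine Finset.sum_congr rfl fun k _ => Finset.sum_congr rfl fun l _ => ?_
      rw [hs.apply j k]
      ring
  rw [e]
  linarith

/-- Expanding `S_{ii'}² S_{jj'}²` with `S_{ii'}² = 1_{i = i'} + offSq S i i'`; only the term that
contains two indicators keeps the band `v`. -/
theorem sum_band_mul_sq_mul_sq_le (hd : ∀ i, S i i = 1) {v : ι → ι → ℝ} {M : ℝ}
    (hvM : ∀ i j, v i j ≤ M) (i j : ι) :
    ∑ i', ∑ j', v i' j' * (S i i' ^ 2 * S j j' ^ 2)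
      ≤ v i j + M * ∑ k, offSq S i k + M * ∑ k, offSq S j k
        + M * ((∑ k, offSq S i k) * ∑ k, offSq S j k) := by
  have e : ∑ i', ∑ j', v i' j' * (S i i' ^ 2 * S j j' ^ 2)
      = v i j + (∑ k, v k j * offSq S i k) + (∑ k, v i k * offSq S j k)
        + ∑ i', ∑ j', v i' j' * (offSq S i i' * offSq S j j') := by
    simp only [sq_eq_offSq_add hd, mul_add, add_mul, Finset.sum_add_distrib]
    simp
    ring
  rw [e, Finset.sum_mul_sum]
  simp only [Finset.mul_sum]
  gcongr with k _ k _ k _ l _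
  · exact offSq_nonneg _ _ _
  · exact hvM _ _
  · exact offSq_nonneg _ _ _
  · exact hvM _ _
  · exact mul_nonneg (offSq_nonneg _ _ _) (offSq_nonneg _ _ _)
  · exact hvM _ _

theorem sum_band_sq_le (hd : ∀ i, S i i = 1) {v : ι → ι → ℝ} {M V : ℝ} (hM : 0 ≤ M)
    (hv0 : ∀ i j, 0 ≤ v i j) (hvM : ∀ i j, v i j ≤ M) (hvs : ∀ i j, v i j = v j i)
    (hV : ∀ i, ∑ j, v i j ≤ V) :
    ∑ i, ∑ j, v i j * ∑ i', ∑ j', v i' j' * (S i i' ^ 2 * S j j' ^ 2)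
      ≤ M * V * Fintype.card ι + 2 * M * V * offEnergy S + (M * offEnergy S) ^ 2 := by
  set r : ι → ℝ := fun i => ∑ k, offSq S i k with hr
  have hr0 (i : ι) : 0 ≤ r i := Finset.sum_nonneg fun _ _ => offSq_nonneg _ _ _
  have hR : offEnergy S = ∑ i, r i := rfl
  calc ∑ i, ∑ j, v i j * ∑ i', ∑ j', v i' j' * (S i i' ^ 2 * S j j' ^ 2)
      ≤ ∑ i, ∑ j, v i j * (v i j + M * r i + M * r j + M * (r i * r j)) := by
        refine Finset.sum_le_sum fun i _ => Finset.sum_le_sum fun j _ => ?_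
        exact mul_le_mul_of_nonneg_left (sum_band_mul_sq_mul_sq_le hd hvM i j) (hv0 i j)
    _ = ∑ i, ∑ j, v i j * v i j + M * (∑ i, r i * ∑ j, v i j) + M * (∑ j, r j * ∑ i, v j i)
        + M * ∑ i, ∑ j, v i j * (r i * r j) := by
        simp only [mul_add, Finset.sum_add_distrib, Finset.mul_sum]
        congr 1
        · congr 1
          · congr 1
            exact Finset.sum_congr rfl fun i _ => Finset.sum_congr rfl fun j _ => by ring
          · rw [Finset.sum_comm]
            refine Finset.sum_congr rfl fun i _ => Finset.sum_congr rfl fun j _ => ?_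
            rw [hvs j i]; ring
        · exact Finset.sum_congr rfl fun i _ => Finset.sum_congr rfl fun j _ => by ring
    _ ≤ ∑ _i : ι, M * V + M * (∑ i, r i * V) + M * (∑ j, r j * V)
        + M * ∑ i, ∑ j, M * (r i * r j) := by
        have h1 : ∑ i, ∑ j, v i j * v i j ≤ ∑ _i : ι, M * V := by
          refine Finset.sum_le_sum fun i _ => ?_
          calc ∑ j, v i j * v i j ≤ ∑ j, M * v i j := Finset.sum_le_sum fun j _ =>
                mul_le_mul_of_nonneg_right (hvM i j) (hv0 i j)
            _ = M * ∑ j, v i j := by rw [Finset.mul_sum]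
            _ ≤ M * V := mul_le_mul_of_nonneg_left (hV i) hM
        have h2 : ∑ i, r i * ∑ j, v i j ≤ ∑ i, r i * V := Finset.sum_le_sum fun i _ =>
          mul_le_mul_of_nonneg_left (hV i) (hr0 i)
        have h3 : ∑ i, ∑ j, v i j * (r i * r j) ≤ ∑ i, ∑ j, M * (r i * r j) :=
          Finset.sum_le_sum fun i _ => Finset.sum_le_sum fun j _ =>
            mul_le_mul_of_nonneg_right (hvM i j) (mul_nonneg (hr0 i) (hr0 j))
        gcongr
    _ = _ := by
        simp only [← Finset.mul_sum, ← Finset.sum_mul, ← hR, Finset.sum_const, Finset.card_univ,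
          nsmul_eq_mul]
        ring

/-- A bound for the second moment of the kernel of the degenerate part of the U-statistic, for
weights dominated by a symmetric band kernel `v` with entries at most `M` and row sums at most
`V`. -/
theorem sum_weight_cov_sq_le (hd : ∀ i, S i i = 1) {w v : ι → ι → ℝ} {M V : ℝ} (hM : 0 ≤ M)
    (hw0 : ∀ i j, 0 ≤ w i j) (hwv : ∀ i j, w i j ≤ v i j)
    (hvM : ∀ i j, v i j ≤ M) (hvs : ∀ i j, v i j = v j i) (hV : ∀ i, ∑ j, v i j ≤ V) :
    ∑ q : ι × ι, ∑ q' : ι × ι, w q.1 q.2 * w q'.1 q'.2 *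
      (S q.1 q'.1 * S q.2 q'.2 + S q.1 q'.2 * S q.2 q'.1) ^ 2
      ≤ 4 * (M * V * Fintype.card ι + 2 * M * V * offEnergy S + (M * offEnergy S) ^ 2) := by
  have hv0 (i j : ι) : 0 ≤ v i j := (hw0 i j).trans (hwv i j)
  have h := sum_band_sq_le hd hM hv0 hvM hvs hV
  refine le_trans ?_ (mul_le_mul_of_nonneg_left h (by norm_num : (0:ℝ) ≤ 4))
  simp only [Fintype.sum_prod_type]
  have e : 4 * ∑ i, ∑ j, v i j * ∑ i', ∑ j', v i' j' * (S i i' ^ 2 * S j j' ^ 2)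
      = ∑ i, ∑ j, ∑ i', ∑ j', v i j * v i' j' *
        (2 * (S i i' * S j j') ^ 2 + 2 * (S i j' * S j i') ^ 2) := by
    -- exchange the names of `i'` and `j'`; `v` is symmetric
    have e2 (i j : ι) : ∑ i', ∑ j', v i' j' * (S i j' * S j i') ^ 2
        = ∑ i', ∑ j', v i' j' * (S i i' * S j j') ^ 2 := by
      rw [Finset.sum_comm]
      exact Finset.sum_congr rfl fun k _ => Finset.sum_congr rfl fun l _ => by rw [hvs l k]
    simp only [Finset.mul_sum (s := Finset.univ) (a := (4:ℝ))]
    refine Finset.sum_congr rfl fun i _ => Finset.sum_congr rfl fun j _ => ?_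
    have : ∑ i', ∑ j', v i j * v i' j' * (2 * (S i i' * S j j') ^ 2 + 2 * (S i j' * S j i') ^ 2)
        = 2 * v i j * ∑ i', ∑ j', v i' j' * (S i i' * S j j') ^ 2
          + 2 * v i j * ∑ i', ∑ j', v i' j' * (S i j' * S j i') ^ 2 := by
      simp only [Finset.mul_sum, ← Finset.sum_add_distrib]
      exact Finset.sum_congr rfl fun k _ => Finset.sum_congr rfl fun l _ => by ring
    rw [this, e2]
    simp only [mul_pow]
    ring
  rw [e]
  refine Finset.sum_le_sum fun i _ => Finset.sum_le_sum fun j _ => Finset.sum_le_sum fun i' _ =>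
    Finset.sum_le_sum fun j' _ => ?_
  have h2 : (S i i' * S j j' + S i j' * S j i') ^ 2
      ≤ 2 * (S i i' * S j j') ^ 2 + 2 * (S i j' * S j i') ^ 2 := by
    nlinarith [sq_nonneg (S i i' * S j j' - S i j' * S j i')]
  exact mul_le_mul (mul_le_mul (hwv i j) (hwv i' j') (hw0 _ _) (hv0 _ _)) h2 (sq_nonneg _)
    (mul_nonneg (hv0 _ _) (hv0 _ _))

end FiniteSums

/-! ### Hoeffding decomposition of the statistic -/

section Chebyshev

theorem measure_abs_ge_le {Ω : Type*} [MeasurableSpace Ω] {μ : Measure Ω} [IsProbabilityMeasure μ]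
    {f : Ω → ℝ} (hf : MemLp f 2 μ) {ε B : ℝ} (hε : 0 < ε) (hB : ∫ x, f x ^ 2 ∂μ ≤ B) :
    μ {x | ε ≤ |f x|} ≤ ENNReal.ofReal (B / ε ^ 2) := by
  have h := mul_meas_ge_le_integral_of_nonneg (μ := μ) (f := fun x => f x ^ 2)
    (Eventually.of_forall fun x => sq_nonneg _) hf.integrable_sq (ε ^ 2)
  have e : {x | ε ^ 2 ≤ f x ^ 2} = {x | ε ≤ |f x|} := by
    ext x
    simp only [Set.mem_ofPred_eq]
    rw [sq_le_sq, abs_of_pos hε]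
  rw [e] at h
  rw [← ofReal_measureReal (by finiteness)]
  refine ENNReal.ofReal_le_ofReal ?_
  rw [le_div_iff₀ (by positivity), mul_comm]
  exact h.trans hB

end Chebyshev

section Hoeffding

variable {n p : ℕ} {S : Matrix (Fin p) (Fin p) ℝ}

instance : IsProbabilityMeasure (sampleLaw n p S) := by
  unfold sampleLaw; infer_instance

/-- The centred product `y_i y_j - S_{ij}`. -/
def centredProd (S : Matrix (Fin p) (Fin p) ℝ) (q : Fin p × Fin p) (y : EuclideanSpace ℝ (Fin p)) :
    ℝ := y q.1 * y q.2 - S q.1 q.2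

theorem memLp_centredProd (q : Fin p × Fin p) :
    MemLp (centredProd S q) 2 (multivariateGaussian (0 : EuclideanSpace ℝ (Fin p)) S) :=
  (memLp_coord_mul q.1 q.2).sub (memLp_const _)

theorem integral_centredProd (hS : S.PosSemidef) (q : Fin p × Fin p) :
    ∫ y, centredProd S q y ∂(multivariateGaussian (0 : EuclideanSpace ℝ (Fin p)) S) = 0 := by
  unfold centredProd
  rw [integral_sub ((memLp_coord_mul q.1 q.2).integrable one_le_two) (integrable_const _),
    integral_coord_mul hS]
  simp

theorem integral_centredProd_mul (hS : S.PosSemidef) (q q' : Fin p × Fin p) :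
    ∫ y, centredProd S q y * centredProd S q' y
      ∂(multivariateGaussian (0 : EuclideanSpace ℝ (Fin p)) S)
      = S q.1 q'.1 * S q.2 q'.2 + S q.1 q'.2 * S q.2 q'.1 := by
  have h1 (q : Fin p × Fin p) := (memLp_coord_mul (S := S) q.1 q.2).integrable one_le_two
  have e (y : EuclideanSpace ℝ (Fin p)) : centredProd S q y * centredProd S q' y
      = y q.1 * y q.2 * (y q'.1 * y q'.2) - S q'.1 q'.2 * (y q.1 * y q.2)
        - S q.1 q.2 * (y q'.1 * y q'.2) + S q.1 q.2 * S q'.1 q'.2 := by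
    unfold centredProd; ring
  simp_rw [e]
  have h2 (r : ℝ) (q : Fin p × Fin p) := (h1 q).const_mul r
  have h4 := integrable_coord_mul_four (S := S) q.1 q.2 q'.1 q'.2
  rw [integral_add ((h4.sub' (h2 _ q)).sub' (h2 _ q')) (integrable_const _),
    integral_sub (h4.sub' (h2 _ q)) (h2 _ q'), integral_sub h4 (h2 _ q),
    integral_const_mul, integral_const_mul, integral_coord_mul_four hS, integral_coord_mul hS,
    integral_coord_mul hS]
  simp
  ring

/-- The weights `w*_{ij}` restricted to `i < j`. -/
def upperWeight (p : ℕ) (α L φ : ℝ) (q : Fin p × Fin p) : ℝ :=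
  if q.1 < q.2 then weight α L φ q.1 q.2 else 0

theorem sum_Ioi_eq_sum_prod (f g : Fin p → Fin p → ℝ) :
    ∑ i, ∑ j ∈ Finset.Ioi i, f i j * g i j
      = ∑ q : Fin p × Fin p, (if q.1 < q.2 then f q.1 q.2 else 0) * g q.1 q.2 := by
  rw [Fintype.sum_prod_type]
  refine Finset.sum_congr rfl fun i _ => ?_
  have : Finset.Ioi i = Finset.univ.filter (i < ·) := by ext; simp
  rw [this, Finset.sum_filter]
  exact Finset.sum_congr rfl fun j _ => by simp

/-- The signal `∑_{i<j} w*_{ij} S_{ij}²`, which is `p` times the mean of the statistic. -/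
def signal (α L φ : ℝ) (S : Matrix (Fin p) (Fin p) ℝ) : ℝ :=
  ∑ i, ∑ j ∈ Finset.Ioi i, weight α L φ i j * S i j ^ 2

theorem sum_offdiag_add (G : Fin n → ℝ) (H : Fin n → Fin n → ℝ) (m : ℝ) :
    ∑ k, ∑ l with l ≠ k, (H k l + G k + G l + m)
      = (∑ k, ∑ l with l ≠ k, H k l) + 2 * (n - 1) * (∑ k, G k) + n * (n - 1) * m := by
  have h (F : Fin n → Fin n → ℝ) : ∑ k, ∑ l with l ≠ k, F k l = ∑ k, ∑ l, F k l - ∑ k, F k k := by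
    rw [← Finset.sum_sub_distrib]
    refine Finset.sum_congr rfl fun k _ => ?_
    rw [Finset.filter_ne', Finset.sum_erase_eq_sub (Finset.mem_univ k)]
  rw [h, h]
  simp only [Finset.sum_add_distrib, Finset.sum_const, Finset.card_univ, Fintype.card_fin,
    nsmul_eq_mul, ← Finset.mul_sum]
  ring

/-- The Hoeffding decomposition of the statistic. -/
theorem statD_sub_eq (hn : 2 ≤ n) (hp : 1 ≤ p) (α L φ : ℝ) (S : Matrix (Fin p) (Fin p) ℝ)
    (x : Sample n p) :
    statD n p α L φ x - signal α L φ S / p = 1 / ((n : ℝ) * (n - 1) * p) *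
      ((∑ k, ∑ l with l ≠ k, uKernel (upperWeight p α L φ) (centredProd S) (x k) (x l)) +
        2 * (n - 1) * ∑ k, ∑ q, upperWeight p α L φ q * S q.1 q.2 * centredProd S q (x k)) := by
  have hn1 : (n : ℝ) - 1 ≠ 0 := by
    have : (2 : ℝ) ≤ n := by exact_mod_cast hn
    linarith
  have hn0 : (n : ℝ) ≠ 0 := by positivity
  have hp0 : (p : ℝ) ≠ 0 := by positivity
  set G : Fin n → ℝ := fun k => ∑ q, upperWeight p α L φ q * S q.1 q.2 * centredProd S q (x k)
    with hG
  have key (k l : Fin n) :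
      ∑ i, ∑ j ∈ Finset.Ioi i, weight α L φ i j * x k i * x k j * x l i * x l j
        = uKernel (upperWeight p α L φ) (centredProd S) (x k) (x l) + G k + G l
          + signal α L φ S := by
    unfold signal
    rw [sum_Ioi_eq_sum_prod (weight α L φ) fun i j => S i j ^ 2]
    simp_rw [mul_assoc]
    rw [sum_Ioi_eq_sum_prod (weight α L φ) fun i j => x k i * (x k j * (x l i * x l j))]
    simp only [uKernel, hG, ← Finset.sum_add_distrib]
    refine Finset.sum_congr rfl fun q _ => ?_
    unfold centredProd upperWeight
    ring
  unfold statD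
  simp_rw [key]
  rw [sum_offdiag_add]
  field_simp
  ring

theorem memLp_sum_weight_centredProd (w : Fin p × Fin p → ℝ) :
    MemLp (fun y => ∑ q, w q * centredProd S q y) 2
      (multivariateGaussian (0 : EuclideanSpace ℝ (Fin p)) S) :=
  memLp_finsetSum _ fun q _ => (memLp_centredProd q).const_mul _

theorem integral_sum_weight_centredProd (hS : S.PosSemidef) (w : Fin p × Fin p → ℝ) :
    ∫ y, ∑ q, w q * centredProd S q y
      ∂(multivariateGaussian (0 : EuclideanSpace ℝ (Fin p)) S) = 0 := by
  rw [integral_finsetSum _ fun q _ => ((memLp_centredProd q).integrable one_le_two).const_mul _]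
  simp [integral_const_mul, integral_centredProd hS]

theorem integral_sq_sum_weight_centredProd (hS : S.PosSemidef) (w : Fin p × Fin p → ℝ) :
    ∫ y, (∑ q, w q * centredProd S q y) ^ 2
      ∂(multivariateGaussian (0 : EuclideanSpace ℝ (Fin p)) S)
      = ∑ q : Fin p × Fin p, ∑ q' : Fin p × Fin p, w q * w q' *
        (S q.1 q'.1 * S q.2 q'.2 + S q.1 q'.2 * S q.2 q'.1) := by
  have hint (q q' : Fin p × Fin p) : Integrable
      (fun y => w q * w q' * (centredProd S q y * centredProd S q' y))
      (multivariateGaussian (0 : EuclideanSpace ℝ (Fin p)) S) :=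
    ((memLp_centredProd q).integrable_mul (memLp_centredProd q')).const_mul _
  have e (y : EuclideanSpace ℝ (Fin p)) : (∑ q, w q * centredProd S q y) ^ 2
      = ∑ q, ∑ q', w q * w q' * (centredProd S q y * centredProd S q' y) := by
    rw [sq, Finset.sum_mul_sum]
    exact Finset.sum_congr rfl fun q _ => Finset.sum_congr rfl fun q' _ => by ring
  simp_rw [e]
  rw [integral_finsetSum _ fun k _ => integrable_finsetSum _ fun l _ => hint k l]
  simp_rw [integral_finsetSum _ fun l _ => hint _ l, integral_const_mul,
    integral_centredProd_mul hS]

theorem memLp_degenerate_part {w : Fin p × Fin p → ℝ} :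
    MemLp (fun x : Sample n p => ∑ k, ∑ l with l ≠ k, uKernel w (centredProd S) (x k) (x l)) 2
      (sampleLaw n p S) := by
  refine memLp_finsetSum _ fun k _ => memLp_finsetSum _ fun l hl => ?_
  have hkl : k ≠ l := ((Finset.mem_filter.1 hl).2).symm
  exact memLp_uKernel memLp_centredProd hkl

theorem memLp_linear_part {w : Fin p × Fin p → ℝ} :
    MemLp (fun x : Sample n p => ∑ k, ∑ q, w q * centredProd S q (x k)) 2 (sampleLaw n p S) :=
  memLp_finsetSum _ fun k _ =>
    (memLp_sum_weight_centredProd w).comp_measurePreserving (measurePreserving_eval _ k)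

theorem memLp_statD_sub (hn : 2 ≤ n) (hp : 1 ≤ p) (α L φ : ℝ) :
    MemLp (fun x => statD n p α L φ x - signal α L φ S / p) 2 (sampleLaw n p S) := by
  simp_rw [statD_sub_eq hn hp α L φ S]
  exact (memLp_degenerate_part.add (memLp_linear_part.const_mul _)).const_mul _

/-- The contributions of the linear and of the degenerate part of the Hoeffding decomposition. They
are combined by `(a + b)² ≤ 2 a² + 2 b²`, which spares the proof of their orthogonality. -/
theorem integral_sq_statD_sub_le (hn : 2 ≤ n) (hp : 1 ≤ p) (α L φ : ℝ) (hS : S.PosSemidef) :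
    ∫ x, (statD n p α L φ x - signal α L φ S / p) ^ 2 ∂(sampleLaw n p S)
      ≤ 8 / ((n : ℝ) * p ^ 2) * (∑ q : Fin p × Fin p, ∑ q' : Fin p × Fin p,
          (upperWeight p α L φ q * S q.1 q.2) * (upperWeight p α L φ q' * S q'.1 q'.2) *
          (S q.1 q'.1 * S q.2 q'.2 + S q.1 q'.2 * S q.2 q'.1))
        + 4 / ((n : ℝ) * (n - 1) * p ^ 2) * ∑ q : Fin p × Fin p, ∑ q' : Fin p × Fin p,
          upperWeight p α L φ q * upperWeight p α L φ q' *
          (S q.1 q'.1 * S q.2 q'.2 + S q.1 q'.2 * S q.2 q'.1) ^ 2 := by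
  have hn1 : 0 < (n : ℝ) - 1 := by
    have : (2 : ℝ) ≤ n := by exact_mod_cast hn
    linarith
  have hn0 : 0 < (n : ℝ) := by positivity
  have hp0 : 0 < (p : ℝ) := by positivity
  set W := upperWeight p α L φ with hW
  set g : EuclideanSpace ℝ (Fin p) → ℝ := fun y => ∑ q, W q * S q.1 q.2 * centredProd S q y with hg
  set ν := multivariateGaussian (0 : EuclideanSpace ℝ (Fin p)) S with hν
  set Hs : Sample n p → ℝ := fun x => ∑ k, ∑ l with l ≠ k, uKernel W (centredProd S) (x k) (x l)
    with hHs
  set Gs : Sample n p → ℝ := fun x => ∑ k, g (x k) with hGs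
  have hgL : MemLp g 2 ν := memLp_sum_weight_centredProd _
  have hHL : MemLp Hs 2 (sampleLaw n p S) := memLp_degenerate_part
  have hGL : MemLp Gs 2 (sampleLaw n p S) := memLp_linear_part
  have hG2 := integral_sq_sum_eval (n := n) hgL (integral_sum_weight_centredProd hS _)
  have hH2 := integral_sq_sum_uKernel (n := n) (w := W) (ν := ν) (memLp_centredProd (S := S))
    (integral_centredProd hS)
  simp only [hν, integral_centredProd_mul hS] at hH2
  rw [hν, hg, integral_sq_sum_weight_centredProd hS] at hG2
  set c : ℝ := 1 / ((n : ℝ) * (n - 1) * p) with hc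
  calc ∫ x, (statD n p α L φ x - signal α L φ S / p) ^ 2 ∂(sampleLaw n p S)
      ≤ ∫ x, (2 * c ^ 2 * Hs x ^ 2 + 2 * c ^ 2 * (2 * (n - 1)) ^ 2 * Gs x ^ 2)
          ∂(sampleLaw n p S) := by
        refine integral_mono (memLp_statD_sub hn hp α L φ).integrable_sq
          ((hHL.integrable_sq.const_mul _).add (hGL.integrable_sq.const_mul _)) fun x => ?_
        simp only [statD_sub_eq hn hp α L φ S]
        change (c * (Hs x + 2 * (n - 1) * Gs x)) ^ 2 ≤ _
        nlinarith [mul_nonneg (sq_nonneg c) (sq_nonneg (Hs x - 2 * (n - 1) * Gs x))]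
    _ = 2 * c ^ 2 * ∫ x, Hs x ^ 2 ∂(sampleLaw n p S)
        + 2 * c ^ 2 * (2 * (n - 1)) ^ 2 * ∫ x, Gs x ^ 2 ∂(sampleLaw n p S) := by
        rw [integral_add (hHL.integrable_sq.const_mul _) (hGL.integrable_sq.const_mul _),
          integral_const_mul, integral_const_mul]
    _ = _ := by
        have e1 : ∫ x, Hs x ^ 2 ∂(sampleLaw n p S) = _ := hH2
        have e2 : ∫ x, Gs x ^ 2 ∂(sampleLaw n p S) = _ := hG2
        rw [e1, e2, hc]
        field_simp
        ring

end Hoeffding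

/-! ### The weights and the mean of the statistic -/

section Weights

/-- The height `λ / (2 b)` of the weights. -/
def weightMax (α L φ : ℝ) : ℝ := lam α L φ / (2 * bFun α L φ)

/-- The constant `K` with `T (λ / (2 b))² ≤ K`. -/
def constK (α L : ℝ) : ℝ := (constLam α L / (2 * Real.sqrt (constC α L))) ^ 2 * constT α L

variable {α L φ : ℝ}

theorem constT_pos (hα : 0 < α) (hL : 0 < L) : 0 < constT α L := by unfold constT; positivity

theorem constLam_pos (hα : 0 < α) (hL : 0 < L) : 0 < constLam α L := by unfold constLam; positivity

theorem constC_pos (hα : 0 < α) (hL : 0 < L) : 0 < constC α L := by unfold constC; positivity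

theorem bFun_pos (hα : 0 < α) (hL : 0 < L) (hφ : 0 < φ) : 0 < bFun α L φ := by
  have := constC_pos hα hL
  unfold bFun; positivity

theorem weightMax_pos (hα : 0 < α) (hL : 0 < L) (hφ : 0 < φ) : 0 < weightMax α L φ := by
  have := constLam_pos hα hL
  have := bFun_pos hα hL hφ
  unfold weightMax lam; positivity

theorem constK_nonneg (hα : 0 < α) (hL : 0 < L) : 0 ≤ constK α L := by
  have := constT_pos hα hL
  unfold constK; positivity

theorem weightMax_eq (hα : 0 < α) (hL : 0 < L) (hφ : 0 < φ) :
    weightMax α L φ = constLam α L / (2 * Real.sqrt (constC α L)) * φ ^ (1 / (2 * α)) := by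
  have h1 := Real.sqrt_pos.2 (constC_pos hα hL)
  have h2 : φ ^ ((2 * α + 1) / α) = φ ^ (1 / (2 * α)) * φ ^ (2 + 1 / (2 * α)) := by
    rw [← Real.rpow_add hφ]
    congr 1
    field_simp
    ring
  have h3 : φ ^ (2 + 1 / (2 * α)) ≠ 0 := (Real.rpow_pos_of_pos hφ _).ne'
  unfold weightMax lam bFun
  rw [h2]
  field_simp

/-- This holds for every `φ > 0`, since `M²` is of the exact order `φ^{1/α}` and `T` is at most of
order `φ^{-1/α}`. -/
theorem weightMax_sq_mul_bandT_le (hα : 0 < α) (hL : 0 < L) (hφ : 0 < φ) :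
    weightMax α L φ ^ 2 * bandT α L φ ≤ constK α L := by
  have hT := constT_pos hα hL
  have h1 : (bandT α L φ : ℝ) ≤ constT α L * φ ^ (-(1 / α)) := Nat.floor_le (by positivity)
  have h2 : (φ ^ (1 / (2 * α))) ^ 2 * φ ^ (-(1 / α)) = 1 := by
    rw [← Real.rpow_natCast, ← Real.rpow_mul hφ.le, ← Real.rpow_add hφ]
    have : 1 / (2 * α) * ((2 : ℕ) : ℝ) + -(1 / α) = 0 := by push_cast; field_simp; ring
    rw [this, Real.rpow_zero]
  refine (mul_le_mul_of_nonneg_left h1 (sq_nonneg _)).trans_eq ?_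
  rw [weightMax_eq hα hL hφ, mul_pow, constK]
  calc _ = (constLam α L / (2 * Real.sqrt (constC α L))) ^ 2 * constT α L *
        ((φ ^ (1 / (2 * α))) ^ 2 * φ ^ (-(1 / α))) := by ring
    _ = _ := by rw [h2, mul_one]

/-- The normalisation behind the choice of the constants: `4α/(4α+1)` is the share of the energy
`φ²` that the weights retain in the limit, and `b(φ)` the resulting mean of the statistic. -/
theorem weightMax_mul_sq (hα : 0 < α) (hL : 0 < L) (hφ : 0 < φ) :
    weightMax α L φ * φ ^ 2 * (4 * α / (4 * α + 1)) = bFun α L φ := by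
  have hC := constC_pos hα hL
  have h1 := Real.sqrt_pos.2 hC
  have hx : φ ^ (2 + 1 / (2 * α)) = φ ^ 2 * φ ^ (1 / (2 * α)) := by
    rw [Real.rpow_add hφ, Real.rpow_two]
  have h2 : constLam α L * (2 * α / (4 * α + 1)) = constC α L := by
    unfold constLam constC
    rw [Real.mul_rpow (by positivity) hL.le, Real.rpow_neg (by positivity),
      Real.rpow_add (by positivity), Real.rpow_one]
    have : (4 * α + 1) ^ (1 / (2 * α)) ≠ 0 := by positivity
    field_simp
  rw [weightMax_eq hα hL hφ, bFun, hx]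
  have h3 : constLam α L / (2 * Real.sqrt (constC α L)) * (4 * α / (4 * α + 1))
      = Real.sqrt (constC α L) := by
    have : constLam α L / (2 * Real.sqrt (constC α L)) * (4 * α / (4 * α + 1))
        = constLam α L * (2 * α / (4 * α + 1)) / Real.sqrt (constC α L) := by
      field_simp
      ring
    rw [this, h2, Real.div_sqrt]
  linear_combination φ ^ 2 * φ ^ (1 / (2 * α)) * h3

variable {p : ℕ}

theorem idxDist_nonneg (i j : Fin p) : 0 ≤ idxDist i j := abs_nonneg _

theorem one_le_idxDist {i j : Fin p} (h : i < j) : 1 ≤ idxDist i j := by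
  have h1 : ((i : ℕ) : ℝ) + 1 ≤ ((j : ℕ) : ℝ) := by exact_mod_cast h
  unfold idxDist
  rw [abs_sub_comm]
  exact le_trans (by linarith) (le_abs_self _)

theorem weight_nonneg (hα : 0 < α) (hL : 0 < L) (hφ : 0 < φ) (i j : Fin p) :
    0 ≤ weight α L φ i j := by
  unfold weight
  split_ifs
  · exact mul_nonneg (weightMax_pos hα hL hφ).le (le_max_right _ _)
  · exact le_rfl

theorem weight_le (hα : 0 < α) (hL : 0 < L) (hφ : 0 < φ) (i j : Fin p) :
    weight α L φ i j ≤ if idxDist i j ≤ bandT α L φ then weightMax α L φ else 0 := by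
  unfold weight
  split_ifs
  · refine mul_le_of_le_one_right (weightMax_pos hα hL hφ).le (max_le ?_ zero_le_one)
    have : 0 ≤ (idxDist i j / bandT α L φ) ^ (2 * α) :=
      Real.rpow_nonneg (div_nonneg (idxDist_nonneg i j) (Nat.cast_nonneg _)) _
    linarith
  · exact le_rfl

/-- Outside the band the left side is nonpositive, so the positive part and the truncation can be
dropped. -/
theorem le_weight (hα : 0 < α) (hL : 0 < L) (hφ : 0 < φ) (hT : 0 < bandT α L φ) (i j : Fin p) :
    weightMax α L φ * (1 - idxDist i j ^ (2 * α) / (bandT α L φ : ℝ) ^ (2 * α))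
      ≤ weight α L φ i j := by
  have hM := weightMax_pos hα hL hφ
  have hT' : (0 : ℝ) < bandT α L φ := by exact_mod_cast hT
  rw [← Real.div_rpow (idxDist_nonneg i j) hT'.le]
  unfold weight
  split_ifs with h
  · exact mul_le_mul_of_nonneg_left (le_max_left _ _) hM.le
  · refine mul_nonpos_of_nonneg_of_nonpos hM.le (sub_nonpos.2 ?_)
    refine Real.one_le_rpow ?_ (by positivity)
    rw [one_le_div hT']
    exact (not_le.1 h).le

/-- At most `2 T` indices other than `i` lie within distance `T` of `i`. -/
theorem card_band_le (T : ℕ) (i : Fin p) :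
    (Finset.univ.filter fun j : Fin p => i ≠ j ∧ idxDist i j ≤ T).card ≤ 2 * T := by
  have h : (Finset.univ.filter fun j : Fin p => i ≠ j ∧ idxDist i j ≤ T).card
      ≤ ((Finset.Icc ((i : ℤ) - T) ((i : ℤ) + T)).erase (i : ℤ)).card := by
    refine Finset.card_le_card_of_injOn (fun j => ((j : ℕ) : ℤ)) ?_ ?_
    · intro j hj
      obtain ⟨h1, h2⟩ := (Finset.mem_filter.1 hj).2
      have h3 : |((i : ℕ) : ℤ) - ((j : ℕ) : ℤ)| ≤ T := by
        unfold idxDist at h2; exact_mod_cast h2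
      have h4 := abs_le.1 h3
      have h5 : (j : ℕ) ≠ i := fun h => h1 (Fin.ext h.symm)
      simp only [Finset.coe_erase, Finset.coe_Icc, Set.mem_sdiff, Set.mem_Icc,
        Set.mem_singleton_iff]
      omega
    · intro a _ b _ hab
      have hab' : ((a : ℕ) : ℤ) = ((b : ℕ) : ℤ) := hab
      exact Fin.ext (by exact_mod_cast hab')
  refine h.trans ?_
  rw [Finset.card_erase_of_mem (by simp), Int.card_Icc]
  omega

/-- The indicator of the band `0 < |i - j| ≤ T`, scaled to height `M`. -/
def band (M : ℝ) (T : ℕ) (i j : Fin p) : ℝ := if i ≠ j ∧ idxDist i j ≤ T then M else 0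

theorem band_symm (M : ℝ) (T : ℕ) (i j : Fin p) : band M T i j = band M T j i := by
  unfold band idxDist
  simp only [ne_comm (a := i), abs_sub_comm ((i : ℕ) : ℝ)]

theorem band_le {M : ℝ} (hM : 0 ≤ M) (T : ℕ) (i j : Fin p) : band M T i j ≤ M := by
  unfold band; split_ifs <;> linarith

theorem sum_band_le {M : ℝ} (hM : 0 ≤ M) (T : ℕ) (i : Fin p) : ∑ j, band M T i j ≤ 2 * T * M := by
  unfold band
  rw [← Finset.sum_filter, Finset.sum_const, nsmul_eq_mul]
  refine mul_le_mul_of_nonneg_right ?_ hM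
  exact_mod_cast card_band_le T i

theorem upperWeight_nonneg (hα : 0 < α) (hL : 0 < L) (hφ : 0 < φ) (q : Fin p × Fin p) :
    0 ≤ upperWeight p α L φ q := by
  unfold upperWeight
  split_ifs
  · exact weight_nonneg hα hL hφ _ _
  · exact le_rfl

theorem upperWeight_le_band (hα : 0 < α) (hL : 0 < L) (hφ : 0 < φ) (i j : Fin p) :
    upperWeight p α L φ (i, j) ≤ band (weightMax α L φ) (bandT α L φ) i j := by
  have hM := weightMax_pos hα hL hφ
  unfold upperWeight band
  by_cases h : i < j
  · simp only [h, if_true, h.ne, ne_eq, not_false_eq_true, true_and]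
    exact weight_le hα hL hφ i j
  · rw [if_neg h]
    split_ifs <;> linarith

variable {S : Matrix (Fin p) (Fin p) ℝ}

theorem signal_eq (α L φ : ℝ) (S : Matrix (Fin p) (Fin p) ℝ) :
    signal α L φ S = ∑ q : Fin p × Fin p, upperWeight p α L φ q * S q.1 q.2 ^ 2 :=
  sum_Ioi_eq_sum_prod (weight α L φ) fun i j => S i j ^ 2

theorem frobSq_weighted_le (hα : 0 < α) (hL : 0 < L) (hφ : 0 < φ) :
    frobSq (Matrix.of fun i j => upperWeight p α L φ (i, j) * S i j)
      ≤ weightMax α L φ * signal α L φ S := by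
  rw [signal_eq, Fintype.sum_prod_type, Finset.mul_sum]
  simp_rw [Finset.mul_sum]
  refine Finset.sum_le_sum fun i _ => Finset.sum_le_sum fun j _ => ?_
  have h0 := upperWeight_nonneg hα hL hφ (i, j)
  have h1 := (upperWeight_le_band hα hL hφ i j).trans
    (band_le (weightMax_pos hα hL hφ).le _ i j)
  simp only [Matrix.of_apply]
  have h2 := mul_le_mul_of_nonneg_left (mul_le_mul_of_nonneg_left h1 h0) (sq_nonneg (S i j))
  linarith

theorem offEnergy_eq (hs : S.IsSymm) :
    offEnergy S = 2 * ∑ i, ∑ j ∈ Finset.Ioi i, S i j ^ 2 := by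
  have h1 := sum_Ioi_eq_sum_prod (fun _ _ => (1 : ℝ)) fun i j => S i j ^ 2
  simp only [one_mul, Fintype.sum_prod_type] at h1
  rw [two_mul, h1]
  nth_rewrite 2 [Finset.sum_comm]
  rw [offEnergy, ← Finset.sum_add_distrib]
  refine Finset.sum_congr rfl fun i _ => ?_
  rw [← Finset.sum_add_distrib]
  refine Finset.sum_congr rfl fun j _ => ?_
  unfold offSq
  rcases lt_trichotomy i j with h | h | h
  · simp [h, h.ne, h.not_gt]
  · simp [h]
  · simp [h, h.ne', h.not_gt, hs.apply j i]

/-- The mean squared deviation of the statistic from its mean, in terms of the signal and of the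
off-diagonal energy of the covariance matrix. -/
theorem integral_sq_statD_sub_le_energy {n : ℕ} (hn : 2 ≤ n) (hp : 1 ≤ p) (hα : 0 < α) (hL : 0 < L)
    (hφ : 0 < φ) (hS : S.PosSemidef) (hd : ∀ i, S i i = 1) :
    ∫ x, (statD n p α L φ x - signal α L φ S / p) ^ 2 ∂(sampleLaw n p S)
      ≤ 32 / ((n : ℝ) * p ^ 2) * ((1 + offEnergy S) * (weightMax α L φ * signal α L φ S))
        + 32 / ((n : ℝ) ^ 2 * p ^ 2) * (2 * constK α L * p + 4 * constK α L * offEnergy S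
          + (weightMax α L φ * offEnergy S) ^ 2) := by
  have hs : S.IsSymm := by
    have := hS.isHermitian
    rwa [Matrix.IsHermitian, Matrix.conjTranspose_eq_transpose_of_trivial] at this
  have hM := weightMax_pos hα hL hφ
  have hn2 : (2 : ℝ) ≤ n := by exact_mod_cast hn
  have hp0 : 0 < (p : ℝ) := by positivity
  have hR := offEnergy_nonneg S
  have hK := weightMax_sq_mul_bandT_le hα hL hφ
  refine (integral_sq_statD_sub_le hn hp α L φ hS).trans ?_
  have h1 := (sum_quadratic_form_le hs hd
    (Matrix.of fun i j => upperWeight p α L φ (i, j) * S i j)).trans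
    (mul_le_mul_of_nonneg_left (frobSq_weighted_le hα hL hφ) (by positivity))
  have h2 := sum_weight_cov_sq_le (S := S) (w := fun i j => upperWeight p α L φ (i, j))
    (v := band (weightMax α L φ) (bandT α L φ)) hd hM.le
    (fun i j => upperWeight_nonneg hα hL hφ _) (upperWeight_le_band hα hL hφ)
    (band_le hM.le _) (band_symm _ _) (sum_band_le hM.le _)
  simp only [Matrix.of_apply, Fintype.card_fin] at h1 h2
  have h3 : weightMax α L φ * (2 * bandT α L φ * weightMax α L φ) ≤ 2 * constK α L := by
    linarith
  -- `n (n - 1) ≥ n² / 2` for `n ≥ 2`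
  have h4 : 4 / ((n : ℝ) * (n - 1) * p ^ 2) ≤ 8 / ((n : ℝ) ^ 2 * p ^ 2) := by
    rw [div_le_div_iff₀ (by have : 0 < (n : ℝ) - 1 := by linarith
                            positivity) (by positivity)]
    nlinarith [mul_nonneg (mul_nonneg (by linarith : (0 : ℝ) ≤ n) (by linarith : (0 : ℝ) ≤ n - 2))
      (sq_nonneg (p : ℝ))]
  have h5 : 4 * (weightMax α L φ * (2 * bandT α L φ * weightMax α L φ) * p
      + 2 * weightMax α L φ * (2 * bandT α L φ * weightMax α L φ) * offEnergy S
      + (weightMax α L φ * offEnergy S) ^ 2)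
      ≤ 4 * (2 * constK α L * p + 4 * constK α L * offEnergy S
          + (weightMax α L φ * offEnergy S) ^ 2) := by
    have := mul_le_mul_of_nonneg_right h3 hp0.le
    have := mul_le_mul_of_nonneg_right h3 hR
    nlinarith
  have h6 : 0 ≤ 4 * (2 * constK α L * p + 4 * constK α L * offEnergy S
          + (weightMax α L φ * offEnergy S) ^ 2) := by
    have := constK_nonneg hα hL
    positivity
  have h7 := mul_le_mul_of_nonneg_left h1 (by positivity : 0 ≤ 8 / ((n : ℝ) * p ^ 2))
  have h8 : 0 ≤ 4 / ((n : ℝ) * (n - 1) * p ^ 2) := by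
    have : 0 < (n : ℝ) - 1 := by linarith
    positivity
  have h9 := (mul_le_mul_of_nonneg_left (h2.trans h5) h8).trans
    (mul_le_mul_of_nonneg_right h4 h6)
  refine (add_le_add h7 h9).trans_eq ?_
  ring

/-- The mean of the statistic dominates the energy of the covariance matrix, as soon as the
smoothness condition makes the entries outside the band negligible. -/
theorem le_signal (hα : 0 < α) (hL : 0 < L) (hφ : 0 < φ) (hT : 0 < bandT α L φ) (hp : 1 ≤ p)
    {θ : ℝ} (hθ : L ≤ θ * φ ^ 2 * (bandT α L φ : ℝ) ^ (2 * α)) (hθ0 : 0 ≤ θ)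
    (hS : S ∈ classQ p α L φ) :
    weightMax α L φ * (1 - θ) * ∑ i, ∑ j ∈ Finset.Ioi i, S i j ^ 2 ≤ signal α L φ S := by
  obtain ⟨⟨-, -, h1⟩, h2⟩ := hS
  have hM := weightMax_pos hα hL hφ
  have hp0 : 0 < (p : ℝ) := by positivity
  have hT' : 0 < (bandT α L φ : ℝ) ^ (2 * α) := by
    have : (0 : ℝ) < bandT α L φ := by exact_mod_cast hT
    positivity
  set B := (bandT α L φ : ℝ) ^ (2 * α)
  set s := ∑ i, ∑ j ∈ Finset.Ioi i, S i j ^ 2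
  set e := ∑ i, ∑ j ∈ Finset.Ioi i, S i j ^ 2 * idxDist i j ^ (2 * α)
  have h3 : weightMax α L φ * (s - e / B) ≤ signal α L φ S := by
    simp only [s, e, signal, Finset.sum_div, ← Finset.sum_sub_distrib, Finset.mul_sum]
    refine Finset.sum_le_sum fun i _ => Finset.sum_le_sum fun j _ => ?_
    have := mul_le_mul_of_nonneg_right (le_weight hα hL hφ hT i j) (sq_nonneg (S i j))
    refine le_trans (le_of_eq ?_) this
    ring
  have h4 : e / B ≤ θ * s := by
    rw [div_le_iff₀ hT']
    rw [one_div, inv_mul_le_iff₀ hp0] at h1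
    rw [one_div, le_inv_mul_iff₀ hp0] at h2
    have h5 := mul_le_mul_of_nonneg_left hθ hp0.le
    have h6 := mul_le_mul_of_nonneg_left h2 (mul_nonneg hθ0 hT'.le)
    linarith
  refine le_trans ?_ h3
  rw [mul_assoc]
  exact mul_le_mul_of_nonneg_left (by linarith) hM.le

/-- The smoothness condition controls the whole off-diagonal energy because `|i - j| ≥ 1`. -/
theorem sum_sq_le_of_mem_classF (hα : 0 < α) (hp : 1 ≤ p) (hS : S ∈ classF p α L) :
    ∑ i, ∑ j ∈ Finset.Ioi i, S i j ^ 2 ≤ p * L := by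
  have hp0 : 0 < (p : ℝ) := by positivity
  have h := hS.2.2
  rw [one_div, inv_mul_le_iff₀ hp0] at h
  refine le_trans (Finset.sum_le_sum fun i _ => Finset.sum_le_sum fun j hj => ?_) h
  exact le_mul_of_one_le_right (sq_nonneg _)
    (Real.one_le_rpow (one_le_idxDist (Finset.mem_Ioi.1 hj)) (by positivity))

end Weights

/-! ### Error probabilities and their limits -/

section Errors

variable {α L φ : ℝ} {n p : ℕ} {S : Matrix (Fin p) (Fin p) ℝ}

theorem typeI_starTest (t : ℝ) :
    typeI (starTest n p α L φ t) = sampleLaw n p 1 {x | t < statD n p α L φ x} := by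
  have hm : MeasurableSet {x | t < statD n p α L φ x} :=
    measurableSet_lt measurable_const (measurable_statD n p α L φ)
  unfold typeI starTest
  rw [← lintegral_indicator_one hm]
  congr 1
  funext x
  by_cases h : x ∈ {x | t < statD n p α L φ x} <;> simp [Set.indicator, h]

theorem lintegral_one_sub_starTest (t : ℝ) :
    ∫⁻ x, ENNReal.ofReal (1 - (starTest n p α L φ t).toFun x) ∂(sampleLaw n p S)
      = sampleLaw n p S {x | statD n p α L φ x ≤ t} := by
  have hm : MeasurableSet {x | statD n p α L φ x ≤ t} :=
    measurableSet_le (measurable_statD n p α L φ) measurable_const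
  unfold starTest
  rw [← lintegral_indicator_one hm]
  congr 1
  funext x
  by_cases h : statD n p α L φ x ≤ t
  · simp [Set.indicator, h, not_lt.2 h]
  · simp [Set.indicator, h, not_le.1 h]

theorem signal_one (α L φ : ℝ) : signal α L φ (1 : Matrix (Fin p) (Fin p) ℝ) = 0 := by
  refine Finset.sum_eq_zero fun i _ => Finset.sum_eq_zero fun j hj => ?_
  rw [Matrix.one_apply_ne (Finset.mem_Ioi.1 hj).ne]
  simp

theorem typeI_starTest_le (hn : 2 ≤ n) (hp : 1 ≤ p) (hα : 0 < α) (hL : 0 < L) (hφ : 0 < φ) {t : ℝ}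
    (ht : 0 < t) :
    typeI (starTest n p α L φ t)
      ≤ ENNReal.ofReal (64 * constK α L / ((n : ℝ) * Real.sqrt p * t) ^ 2) := by
  have hp0 : 0 < (p : ℝ) := by positivity
  have hn0 : 0 < (n : ℝ) := by positivity
  rw [typeI_starTest]
  have h := integral_sq_statD_sub_le_energy (S := (1 : Matrix (Fin p) (Fin p) ℝ)) hn hp hα hL hφ
    Matrix.PosSemidef.one (by simp)
  have h2 := measure_abs_ge_le (memLp_statD_sub (S := 1) hn hp α L φ) ht h
  refine (measure_mono ?_).trans (h2.trans_eq ?_)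
  · intro x hx
    simp only [signal_one, zero_div, sub_zero, Set.mem_ofPred_eq] at hx ⊢
    exact hx.le.trans (le_abs_self _)
  · congr 1
    rw [signal_one, offEnergy_one, mul_pow _ t, mul_pow _ (Real.sqrt _), Real.sq_sqrt hp0.le]
    field_simp
    ring

/-- A uniform bound for the type II error: Chebyshev's inequality, with every occurrence of the
energy of `S` absorbed by the mean of the statistic. -/
theorem typeII_starTest_le (hn : 2 ≤ n) (hp : 1 ≤ p) (hα : 0 < α) (hL : 0 < L) (hφ : 0 < φ)
    (hT : 0 < bandT α L φ) {θ κ c t : ℝ} (hθ : L ≤ θ * φ ^ 2 * (bandT α L φ : ℝ) ^ (2 * α))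
    (hθ0 : 0 ≤ θ) (hθ1 : θ < 1) (hc : 0 ≤ c) (hcκ : c < κ)
    (hκ : κ * bFun α L φ ≤ weightMax α L φ * (1 - θ) * φ ^ 2) (ht : t ≤ c * bFun α L φ) :
    typeII (starTest n p α L φ t) (classQ p α L φ)
      ≤ ENNReal.ofReal ((32 * weightMax α L φ / (n * p * (κ * bFun α L φ)) + 64 / (n * (1 - θ))
        + 32 / (n : ℝ) ^ 2 * (4 / (1 - θ) ^ 2)
        + 32 * (2 * constK α L + 8 * constK α L * L) / (n ^ 2 * p * (κ * bFun α L φ) ^ 2))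
        / (1 - c / κ) ^ 2) := by
  refine iSup₂_le fun S hS => ?_
  rw [lintegral_one_sub_starTest]
  have hκ0 : 0 < κ := hc.trans_lt hcκ
  have hp0 : 0 < (p : ℝ) := by positivity
  have hn0 : 0 < (n : ℝ) := by positivity
  have hb := bFun_pos hα hL hφ
  have hM := weightMax_pos hα hL hφ
  have hK := constK_nonneg hα hL
  have hθ2 : 0 < 1 - θ := by linarith
  have hs : S.IsSymm := by
    have := hS.1.1.isHermitian
    rwa [Matrix.IsHermitian, Matrix.conjTranspose_eq_transpose_of_trivial] at this
  have hR := offEnergy_eq hs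
  have hsig := le_signal hα hL hφ hT hp hθ hθ0 hS
  have hsL := sum_sq_le_of_mem_classF hα hp hS.1
  have hsφ := hS.2
  rw [one_div, le_inv_mul_iff₀ hp0] at hsφ
  have hvar := integral_sq_statD_sub_le_energy hn hp hα hL hφ hS.1.1 hS.1.2.1
  have hmem := memLp_statD_sub (S := S) hn hp α L φ
  rw [hR] at hvar
  set M := weightMax α L φ
  set b := bFun α L φ
  set K := constK α L
  -- `s` is the normalised energy and `E` the mean of the statistic
  obtain ⟨s, hs'⟩ : ∃ s, ∑ i, ∑ j ∈ Finset.Ioi i, S i j ^ 2 = p * s :=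
    ⟨_, (mul_div_cancel₀ _ hp0.ne').symm⟩
  obtain ⟨E, hE⟩ : ∃ E, signal α L φ S = p * E := ⟨_, (mul_div_cancel₀ _ hp0.ne').symm⟩
  rw [hs', hE] at hsig
  rw [hs'] at hsL hsφ hvar
  rw [hE] at hvar
  simp only [hE] at hmem
  rw [mul_div_cancel_left₀ _ hp0.ne'] at hvar
  simp only [mul_div_cancel_left₀ _ hp0.ne'] at hmem
  replace hsL : s ≤ L := le_of_mul_le_mul_left hsL hp0
  replace hsφ : φ ^ 2 ≤ s := le_of_mul_le_mul_left hsφ hp0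
  have hs0 : 0 < s := lt_of_lt_of_le (by positivity) hsφ
  replace hsig : M * (1 - θ) * s ≤ E := by
    refine le_of_mul_le_mul_left ?_ hp0
    linarith
  have hEb : κ * b ≤ E := hκ.trans ((mul_le_mul_of_nonneg_left hsφ (by positivity)).trans hsig)
  have hκb : 0 < κ * b := by positivity
  have hE0 : 0 < E := hκb.trans_le hEb
  have hρ : 0 < 1 - c / κ := sub_pos.2 ((div_lt_one hκ0).2 hcκ)
  have hMs : M * s ≤ E / (1 - θ) := by
    rw [le_div_iff₀ hθ2]; linarith
  have htE : t ≤ c / κ * E := by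
    refine ht.trans ?_
    have := mul_le_mul_of_nonneg_left hEb (by positivity : 0 ≤ c / κ)
    refine le_trans (le_of_eq ?_) this
    field_simp
  have h2 := measure_abs_ge_le hmem (mul_pos hρ hE0) hvar
  refine (measure_mono ?_).trans (h2.trans (ENNReal.ofReal_le_ofReal ?_))
  · intro x hx
    simp only [Set.mem_ofPred_eq] at hx ⊢
    rw [abs_sub_comm]
    refine le_trans ?_ (le_abs_self _)
    linarith
  · rw [mul_pow _ E, mul_comm ((1 - c / κ) ^ 2), ← div_div]
    refine div_le_div_of_nonneg_right ?_ (by positivity)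
    -- the energy enters only through `M s / E ≤ 1 / (1 - θ)` and `s ≤ L`
    have e : (32 / ((n : ℝ) * p ^ 2) * ((1 + 2 * (p * s)) * (M * (p * E)))
        + 32 / ((n : ℝ) ^ 2 * p ^ 2) * (2 * K * p + 4 * K * (2 * (p * s))
          + (M * (2 * (p * s))) ^ 2)) / E ^ 2
        = 32 * M / (n * p * E) + 64 / n * (M * s / E) + 32 / (n : ℝ) ^ 2 * (4 * (M * s / E) ^ 2)
          + 32 * (2 * K + 8 * K * s) / (n ^ 2 * p * E ^ 2) := by
      field_simp
      ring
    have hr : M * s / E ≤ 1 / (1 - θ) := by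
      rw [div_le_div_iff₀ hE0 hθ2]; linarith
    have hr0 : 0 ≤ M * s / E := by positivity
    have e2 : 64 / ((n : ℝ) * (1 - θ)) = 64 / n * (1 / (1 - θ)) := by field_simp
    have e3 : 4 / (1 - θ) ^ 2 = 4 * (1 / (1 - θ)) ^ 2 := by field_simp
    rw [e, e2, e3]
    gcongr

end Errors

section Limits

variable {ι : Type*} {l : Filter ι} {α L : ℝ} {φ : ι → ℝ}

theorem tendsto_constT_mul_rpow (hα : 0 < α) (hL : 0 < L) (hφ : ∀ m, 0 < φ m)
    (h : Tendsto φ l (𝓝 0)) :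
    Tendsto (fun m => constT α L * φ m ^ (-(1 / α))) l atTop := by
  refine Tendsto.const_mul_atTop (constT_pos hα hL) ?_
  exact (tendsto_rpow_neg_nhdsGT_zero (by simpa using hα)).comp
    (tendsto_nhdsWithin_iff.2 ⟨h, Eventually.of_forall hφ⟩)

/-- The bandwidth satisfies `φ² T^{2α} → (4α + 1) L`. -/
theorem tendsto_sq_mul_bandT_rpow (hα : 0 < α) (hL : 0 < L) (hφ : ∀ m, 0 < φ m)
    (h : Tendsto φ l (𝓝 0)) :
    Tendsto (fun m => φ m ^ 2 * (bandT α L (φ m) : ℝ) ^ (2 * α)) l (𝓝 ((4 * α + 1) * L)) := by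
  have hT := constT_pos hα hL
  have h1 := (tendsto_nat_floor_div_atTop (R := ℝ)).comp (tendsto_constT_mul_rpow hα hL hφ h)
  have h2 := (h1.rpow_const (p := 2 * α) (Or.inl one_ne_zero)).mul_const ((4 * α + 1) * L)
  rw [Real.one_rpow, one_mul] at h2
  refine h2.congr fun m => ?_
  have hy : 0 < φ m ^ (-(1 / α)) := Real.rpow_pos_of_pos (hφ m) _
  have e1 : (φ m ^ (-(1 / α))) ^ (2 * α) = (φ m ^ 2)⁻¹ := by
    rw [← Real.rpow_mul (hφ m).le, ← Real.rpow_two, ← Real.rpow_neg (hφ m).le]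
    congr 1
    field_simp
  have e2 : constT α L ^ (2 * α) = (4 * α + 1) * L := by
    unfold constT
    rw [← Real.rpow_mul (by positivity), one_div, inv_mul_cancel₀ (by positivity), Real.rpow_one]
  have hφm := hφ m
  simp only [Function.comp_apply]
  rw [Real.div_rpow (Nat.cast_nonneg _) (by positivity), Real.mul_rpow hT.le hy.le, e1, e2, bandT]
  field_simp

theorem weightMax_le_of_le_one (hα : 0 < α) (hL : 0 < L) {φ : ℝ} (hφ : 0 < φ) (h1 : φ ≤ 1) :
    weightMax α L φ ≤ constLam α L / (2 * Real.sqrt (constC α L)) := by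
  have := constLam_pos hα hL
  rw [weightMax_eq hα hL hφ]
  exact mul_le_of_le_one_right (by positivity) (Real.rpow_le_one hφ.le h1 (by positivity))

variable {n p : ι → ℕ}

theorem tendsto_typeI_starTest (hα : 0 < α) (hL : 0 < L) (hn : Tendsto n l atTop)
    (hp : Tendsto p l atTop) (hφ : ∀ m, 0 < φ m) {t : ι → ℝ} (ht : ∀ m, 0 < t m)
    (h : Tendsto (fun m => (n m : ℝ) * Real.sqrt (p m) * t m) l atTop) :
    Tendsto (fun m => typeI (starTest (n m) (p m) α L (φ m) (t m))) l (𝓝 0) := by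
  have h1 : Tendsto (fun m => 64 * constK α L / ((n m : ℝ) * Real.sqrt (p m) * t m) ^ 2) l (𝓝 0) :=
    Tendsto.const_div_atTop ((tendsto_pow_atTop two_ne_zero).comp h) _
  have h2 := ENNReal.tendsto_ofReal h1
  rw [ENNReal.ofReal_zero] at h2
  refine tendsto_of_tendsto_of_tendsto_of_le_of_le' tendsto_const_nhds h2
    (Eventually.of_forall fun _ => zero_le) ?_
  filter_upwards [hn.eventually_ge_atTop 2, hp.eventually_ge_atTop 1] with m hn2 hp1
  exact typeI_starTest_le hn2 hp1 hα hL (hφ m) (ht m)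

theorem tendsto_iSup_typeII_starTest (hα : 0 < α) (hL : 0 < L) (hn : Tendsto n l atTop)
    (hp : Tendsto p l atTop) (hφ : ∀ m, 0 < φ m) (hφ0 : Tendsto φ l (𝓝 0))
    (h : Tendsto (fun m => (n m : ℝ) ^ 2 * (p m : ℝ) * bFun α L (φ m) ^ 2) l atTop)
    {c : ℝ} (hc : c ∈ Set.Ioo (0 : ℝ) 1) :
    Tendsto (fun m => ⨆ t ∈ Set.Ioc (0 : ℝ) (c * bFun α L (φ m)),
      typeII (starTest (n m) (p m) α L (φ m) t) (classQ (p m) α L (φ m))) l (𝓝 0) := by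
  obtain ⟨hc0, hc1⟩ := hc
  -- `κ` lies strictly between `c` and `1`; then `θ` exceeds the limit `1 / (4α + 1)` of `L / (φ² T^{2α})`.
  set κ : ℝ := (1 + c) / 2 with hκdef
  set θ : ℝ := 1 - κ * (4 * α / (4 * α + 1)) with hθdef
  have hcκ : c < κ := by rw [hκdef]; linarith
  have hκ0 : 0 < κ := by linarith
  have hκ1 : κ < 1 := by rw [hκdef]; linarith
  have hr0 : 0 < 4 * α / (4 * α + 1) := by positivity
  have hr1 : 4 * α / (4 * α + 1) = 1 - 1 / (4 * α + 1) := by field_simp; ring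
  have hθlow : 1 / (4 * α + 1) < θ := by
    have := mul_lt_mul_of_pos_right hκ1 hr0
    rw [hθdef]
    linarith
  have hθ0 : 0 < θ := lt_trans (by positivity) hθlow
  have hθ1 : θ < 1 := by
    have := mul_pos hκ0 hr0
    rw [hθdef]; linarith
  have hθ2 : 0 < 1 - θ := by linarith
  have hevθ : ∀ᶠ m in l, L ≤ θ * φ m ^ 2 * (bandT α L (φ m) : ℝ) ^ (2 * α) := by
    have h1 := (tendsto_sq_mul_bandT_rpow hα hL hφ hφ0).const_mul θ
    have h2 : L < θ * ((4 * α + 1) * L) := by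
      rw [div_lt_iff₀ (by positivity)] at hθlow
      have := mul_lt_mul_of_pos_right hθlow hL
      linarith
    filter_upwards [h1.eventually_const_lt h2] with m hm
    linarith
  have hevT : ∀ᶠ m in l, 0 < bandT α L (φ m) := by
    filter_upwards [(tendsto_constT_mul_rpow hα hL hφ hφ0).eventually_ge_atTop 1] with m hm
    exact Nat.floor_pos.2 hm
  set D : ℝ := constLam α L / (2 * Real.sqrt (constC α L)) with hD
  have hD0 : 0 < D := by
    have := constLam_pos hα hL
    have := constC_pos hα hL
    positivity
  set x : ι → ℝ := fun m => (n m : ℝ) ^ 2 * (p m : ℝ) * bFun α L (φ m) ^ 2 with hx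
  have hnR : Tendsto (fun m => (n m : ℝ)) l atTop := tendsto_natCast_atTop_atTop.comp hn
  have hlim : Tendsto (fun m => (32 * D / κ / Real.sqrt (x m) + 64 / (1 - θ) / (n m : ℝ)
      + 32 * (4 / (1 - θ) ^ 2) / (n m : ℝ) ^ 2
      + 32 * (2 * constK α L + 8 * constK α L * L) / κ ^ 2 / x m) / (1 - c / κ) ^ 2) l (𝓝 0) := by
    have h1 : Tendsto (fun m => 32 * D / κ / Real.sqrt (x m)) l (𝓝 0) :=
      Tendsto.const_div_atTop (Real.tendsto_sqrt_atTop.comp h) _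
    have h2 : Tendsto (fun m => 64 / (1 - θ) / (n m : ℝ)) l (𝓝 0) := Tendsto.const_div_atTop hnR _
    have h3 : Tendsto (fun m => 32 * (4 / (1 - θ) ^ 2) / (n m : ℝ) ^ 2) l (𝓝 0) :=
      Tendsto.const_div_atTop ((tendsto_pow_atTop two_ne_zero).comp hnR) _
    have h4 : Tendsto (fun m => 32 * (2 * constK α L + 8 * constK α L * L) / κ ^ 2 / x m) l (𝓝 0) :=
      Tendsto.const_div_atTop h _
    simpa using (((h1.add h2).add h3).add h4).div_const ((1 - c / κ) ^ 2)
  have hlim' := ENNReal.tendsto_ofReal hlim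
  rw [ENNReal.ofReal_zero] at hlim'
  refine tendsto_of_tendsto_of_tendsto_of_le_of_le' tendsto_const_nhds hlim'
    (Eventually.of_forall fun _ => zero_le) ?_
  filter_upwards [hn.eventually_ge_atTop 2, hp.eventually_ge_atTop 1, hevθ, hevT,
    hφ0.eventually_le_const one_pos] with m hn2 hp1 hθm hTm hφ1
  refine iSup₂_le fun t ht => ?_
  have hκb : κ * bFun α L (φ m) ≤ weightMax α L (φ m) * (1 - θ) * φ m ^ 2 := by
    rw [← weightMax_mul_sq hα hL (hφ m), hθdef]
    exact le_of_eq (by ring)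
  refine (typeII_starTest_le hn2 hp1 hα hL (hφ m) hTm hθm hθ0.le hθ1 hc0.le hcκ hκb ht.2).trans
    (ENNReal.ofReal_le_ofReal (div_le_div_of_nonneg_right ?_ (sq_nonneg _)))
  have hb := bFun_pos hα hL (hφ m)
  have hn0 : 0 < (n m : ℝ) := by positivity
  have hp0 : 0 < (p m : ℝ) := by positivity
  have hp1' : (1 : ℝ) ≤ p m := by exact_mod_cast hp1
  have hM := weightMax_le_of_le_one hα hL (hφ m) hφ1
  have hx0 : 0 < x m := by simp only [hx]; positivity
  have hsqrt : Real.sqrt (x m) ≤ n m * p m * bFun α L (φ m) := by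
    refine Real.sqrt_le_iff.2 ⟨by positivity, ?_⟩
    have : (p m : ℝ) ≤ (p m : ℝ) ^ 2 := by nlinarith
    calc x m ≤ (n m : ℝ) ^ 2 * (p m : ℝ) ^ 2 * bFun α L (φ m) ^ 2 := by
          simp only [hx]; gcongr
      _ = _ := by ring
  have t1 : 32 * weightMax α L (φ m) / (n m * p m * (κ * bFun α L (φ m)))
      ≤ 32 * D / κ / Real.sqrt (x m) := by
    rw [div_div]
    have : n m * p m * (κ * bFun α L (φ m)) = κ * (n m * p m * bFun α L (φ m)) := by ring
    rw [this]
    have := Real.sqrt_pos.2 hx0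
    gcongr
  have t2 : 64 / ((n m : ℝ) * (1 - θ)) = 64 / (1 - θ) / n m := by field_simp
  have t3 : 32 / (n m : ℝ) ^ 2 * (4 / (1 - θ) ^ 2) = 32 * (4 / (1 - θ) ^ 2) / (n m : ℝ) ^ 2 := by
    field_simp
  have t4 : 32 * (2 * constK α L + 8 * constK α L * L)
      / ((n m : ℝ) ^ 2 * p m * (κ * bFun α L (φ m)) ^ 2)
      = 32 * (2 * constK α L + 8 * constK α L * L) / κ ^ 2 / x m := by
    rw [div_div]
    congr 1
    simp only [hx]
    ring
  rw [t2, t3, t4]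
  gcongr

end Limits

end CovTest

end

theorem theorem1 {ι : Type*} (l : Filter ι) (α L : ℝ) (hα : 0 < α) (hL : 0 < L)
    (n p : ι → ℕ) (hn : Tendsto n l atTop) (hp : Tendsto p l atTop)
    (φ : ι → ℝ) (hφ : ∀ m, 0 < φ m) :
    -- type I error
    (∀ t : ι → ℝ, (∀ m, 0 < t m) →
      Tendsto (fun m => (n m : ℝ) * Real.sqrt (p m) * t m) l atTop →
      Tendsto (fun m => CovTest.typeI (CovTest.starTest (n m) (p m) α L (φ m) (t m))) l (𝓝 0)) ∧
    (1 / 2 < α → Tendsto φ l (𝓝 0) →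
      Tendsto (fun m => (p m : ℝ) * φ m ^ (1 / α)) l atTop →
      Tendsto (fun m => (n m : ℝ) ^ 2 * (p m : ℝ) * CovTest.bFun α L (φ m) ^ 2) l atTop →
      ∀ c ∈ Set.Ioo (0 : ℝ) 1,
        -- maximal type II error, uniformly over the thresholds
        Tendsto (fun m => ⨆ t ∈ Set.Ioc (0 : ℝ) (c * CovTest.bFun α L (φ m)),
          CovTest.typeII (CovTest.starTest (n m) (p m) α L (φ m) t)
            (CovTest.classQ (p m) α L (φ m))) l (𝓝 0) ∧
        -- total error
        (∀ t : ι → ℝ, (∀ m, 0 < t m) →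
          Tendsto (fun m => (n m : ℝ) * Real.sqrt (p m) * t m) l atTop →
          (∀ m, t m ≤ c * CovTest.bFun α L (φ m)) →
          Tendsto (fun m => CovTest.totalError (CovTest.starTest (n m) (p m) α L (φ m) (t m))
            (CovTest.classQ (p m) α L (φ m))) l (𝓝 0))) := by
  refine ⟨fun t ht h => CovTest.tendsto_typeI_starTest hα hL hn hp hφ ht h, ?_⟩
  intro _ hφ0 _ hb c hc
  have hII := CovTest.tendsto_iSup_typeII_starTest hα hL hn hp hφ hφ0 hb hc
  refine ⟨hII, fun t ht h htc => ?_⟩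
  have hsum := (CovTest.tendsto_typeI_starTest hα hL hn hp hφ ht h).add hII
  rw [add_zero] at hsum
  refine tendsto_of_tendsto_of_tendsto_of_le_of_le tendsto_const_nhds hsum (fun _ => zero_le)
    fun m => ?_
  refine add_le_add le_rfl ?_
  exact le_iSup₂_of_le (t m) ⟨ht m, htc m⟩ le_rfl
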